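/- Let $K$ be a non-trivially valued field of characteristic $0$ (of equal or mixed characteristic) with valuation ring $\mathcal O_K$ and valuation $|\cdot|\colon K\to\Gamma_K=\Gamma_K^\times\cup\{0\}$, written multiplicatively, considered as a structure in a language $\mathcal L$ containing the language $\{+,\cdot,\mathcal O_K\}$ of valued fields. For an integer $n\ge 1$ let $\mathrm{RV}_{|n|}=\{0\}\cup K^\times/(1+\{x\in K: |x|<|n|\})$, and let $\mathrm{rv}_{|n|}\colon K\to\mathrm{RV}_{|n|}$ be the quotient map, extended by $0\mapsto 0$. A ball $B\subset K$ is $|m|$-next to a finite non-empty set $C\subset K$ if $B=\bigcap_{c\in C}\{x : \mathrm{rv}_{|m|}(x-c)=\xi_c\}$ for some non-zero $\xi_c\in\mathrm{RV}_{|m|}$. A theory $\mathcal T$ of valued fields of characteristic $0$ in $\mathcal L$ is called $1$-h-minimal if, for every model $M$ of $\mathcal T$, every integer $n\ge1$, every set of parameters $A\subset M\cup\mathrm{RV}_{M,|n|}$ and every $A$-definable function $f\colon M\to M$: (T1) there exist a finite non-empty $A$-definable set $C\subset M$ and an integer $m\ge 1$ such that for every ball $B$ that is $|m|$-next to $C$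 there is $\mu_B\in\Gamma_M$ with $\mu_B\,|m|\,|x-y|\le|f(x)-f(y)|\le\mu_B\,|1/m|\,|x-y|$ for all $x,y\in B$; and (T2) the set $\{y\in M : f^{-1}(y)\text{ is infinite}\}$ is finite. **Proposition.** Suppose that $\mathrm{Th}_{\mathcal L}(K)$ is $1$-h-minimal. Then there exists a $\bigcup_n\mathrm{RV}_{|n|}$-expansion $\mathcal L'$ of $\mathcal L$, i.e. an expansion by predicates which live on finite Cartesian products of the sets $\mathrm{RV}_{|n|}$, $n\ge1$, such that $\mathrm{Th}_{\mathcal L'}(K)$ is still $1$-h-minimal and such that for every model $M$ of $\mathrm{Th}_{\mathcal L'}(K)$ and every subset $A\subset M$ one has $$\mathrm{acl}_{\mathcal L',M}(A)=\mathrm{dcl}_{\mathcal L',M}(A).$$ Here $\mathrm{acl}_{\mathcal L',M}(A)$ is the union of all finite $A$-definable subsets of $M$, and $\mathrm{dcl}_{\mathcal L',M}(A)$ is the set of all $a\in M$ such that $\{a\}$ is $A$-definable. (One also says that algebraic Skolem functions exist in all models.) -/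

import Mathlib

open FirstOrder

universe u v w w' r

/-! ## Leading terms

`K` is a field of characteristic zero and `O` a valuation ring of `K`. The value group is written
multiplicatively; `O.valuation : K → O.ValueGroup` is the valuation map `|·|`. -/

namespace HMin

section LeadingTerms

variable {K : Type w} [Field K] (O : ValuationSubring K)

theorem valuation_natCast_le_one (n : ℕ) : O.valuation (n : K) ≤ 1 :=
  (O.valuation_le_one_iff _).2 (natCast_mem O n)

variable [CharZero K]

/-- The subgroup `1 + {x | |x| < |n|}` of `Kˣ`, for a positive integer `n`. -/
def oneAdd (n : ℕ+) : Subgroup Kˣ where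
  carrier := {a | O.valuation ((a : K) - 1) < O.valuation ((n : ℕ) : K)}
  one_mem' := by
    change O.valuation (((1 : Kˣ) : K) - 1) < _
    simp [zero_lt_iff]
  mul_mem' := by
    intro a b ha hb
    have ha1 : O.valuation ((a : K) - 1) < 1 :=
      lt_of_lt_of_le ha (valuation_natCast_le_one O n)
    have hva : O.valuation (a : K) = 1 := by
      have h := O.valuation.map_one_add_of_lt ha1
      simpa using h
    have e : ((a * b : Kˣ) : K) - 1 = (a : K) * ((b : K) - 1) + ((a : K) - 1) := by
      push_cast; ring
    change O.valuation (((a * b : Kˣ) : K) - 1) < _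
    rw [e]
    refine O.valuation.map_add_lt ?_ ha
    rw [map_mul, hva, one_mul]
    exact hb
  inv_mem' := by
    intro a ha
    have ha1 : O.valuation ((a : K) - 1) < 1 :=
      lt_of_lt_of_le ha (valuation_natCast_le_one O n)
    have hva : O.valuation (a : K) = 1 := by
      have h := O.valuation.map_one_add_of_lt ha1
      simpa using h
    have e : ((a⁻¹ : Kˣ) : K) - 1 = -(((a : K) - 1) * (a : K)⁻¹) := by
      have : (a : K) ≠ 0 := a.ne_zero
      push_cast
      field_simp
      ring
    change O.valuation (((a⁻¹ : Kˣ) : K) - 1) < _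
    rw [e, Valuation.map_neg, map_mul, map_inv₀, hva, inv_one, mul_one]
    exact ha

/-- `RV_{|n|}`: the disjoint union of `{0}` and `Kˣ / (1 + {x | |x| < |n|})`. -/
abbrev RV (n : ℕ+) : Type w := WithZero (Kˣ ⧸ oneAdd O n)

open Classical in
/-- The leading term map `rv_{|n|} : K → RV_{|n|}`. -/
noncomputable def rv (n : ℕ+) (x : K) : RV O n :=
  if h : x = 0 then 0 else (((Units.mk0 x h : Kˣ) : Kˣ ⧸ oneAdd O n) : RV O n)

/-- `B` is a ball `|n|`-next to the set `C`: it is a non-empty intersection of sets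
`{x | rv_{|n|} (x - c) = ξ c}` with `ξ c ≠ 0`, one for each `c ∈ C`. (Each of these sets is an open
ball, so that, for finite non-empty `C`, a non-empty intersection of them is an open ball too.) -/
def IsBallNextTo (n : ℕ+) (C B : Set K) : Prop :=
  B.Nonempty ∧ ∃ ξ : K → RV O n, (∀ c ∈ C, ξ c ≠ 0) ∧ B = {x | ∀ c ∈ C, rv O n (x - c) = ξ c}

end LeadingTerms

/-! ## The language of valued fields -/

/-- The function symbols of the language of valued fields: `+` and `·`. -/
inductive ValFunc : ℕ → Type
  | add : ValFunc 2
  | mul : ValFunc 2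

/-- The relation symbols of the language of valued fields: a predicate for the valuation ring. -/
inductive ValRel : ℕ → Type
  | ring : ValRel 1

/-- The language `{+, ·, O}` of valued fields. -/
def langVal : FirstOrder.Language.{0, 0} := ⟨ValFunc, ValRel⟩

/-- The `L`-structure on `K` expands the `{+, ·, O}`-structure of the (non-trivially) valued field
`(K, O)`, where `ι` includes the language of valued fields into `L`. -/
structure IsValuedFieldStructure {L : FirstOrder.Language.{u, v}} (ι : langVal →ᴸ L) (K : Type w) [Field K]
    [L.Structure K] (O : ValuationSubring K) : Prop where
  nontrivial : O ≠ ⊤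
  map_add : ∀ x y : K,
    FirstOrder.Language.Structure.funMap (ι.onFunction (ValFunc.add : langVal.Functions 2)) ![x, y] = x + y
  map_mul : ∀ x y : K,
    FirstOrder.Language.Structure.funMap (ι.onFunction (ValFunc.mul : langVal.Functions 2)) ![x, y] = x * y
  map_ring : ∀ x : K,
    FirstOrder.Language.Structure.RelMap (ι.onRelation (ValRel.ring : langVal.Relations 1)) ![x] ↔ x ∈ O

/-! ## Definability with parameters from `K ∪ RV_{|n|}` -/

section Definability

variable (L : FirstOrder.Language.{u, v}) {K : Type w} [Field K] [CharZero K] [L.Structure K]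
  (O : ValuationSubring K)

/-- The set `X ⊆ K^α` is `L`-definable with parameters from `A ⊆ K` and `B ⊆ RV_{|n|}`: there are
finitely many `ξ i ∈ B` and an `A`-definable family `S` of subsets of `K^α` whose member at `b` is
equal to `X` for every choice `b` of representatives of the `ξ i`. -/
def DefinableOver {n : ℕ+} (A : Set K) (B : Set (RV O n)) {α : Type} (X : Set (α → K)) : Prop :=
  ∃ (k : ℕ) (ξ : Fin k → RV O n) (S : Set (Fin k ⊕ α → K)),
    (∀ i, ξ i ∈ B) ∧ A.Definable L S ∧
      ∀ b : Fin k → K, (∀ i, rv O n (b i) = ξ i) → X = {x | Sum.elim b x ∈ S}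

end Definability

/-! ## 1-h-minimality -/

section HMinimality

variable {L : FirstOrder.Language.{u, v}} {K : Type w} [Field K] [CharZero K]

/-- Property (T1) of `f : K → K`, for the parameter sets `A ⊆ K` and `B ⊆ RV_{|n|}`: for some finite
non-empty definable `C` and some `m ≥ 1`, on each ball `|m|`-next to `C` the function `f` scales
distances by a constant factor `μ`, up to the factor `|m|`. -/
def PropertyT1 (L : FirstOrder.Language.{u, v}) [L.Structure K] (O : ValuationSubring K) {n : ℕ+} (A : Set K)
    (B : Set (RV O n)) (f : K → K) : Prop :=
  ∃ (C : Set K) (m : ℕ+), C.Finite ∧ C.Nonempty ∧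
    DefinableOver L O A B {x : Fin 1 → K | x 0 ∈ C} ∧
    ∀ D : Set K, IsBallNextTo O m C D →
      ∃ μ : O.ValueGroup, ∀ x ∈ D, ∀ y ∈ D,
        μ * O.valuation ((m : ℕ) : K) * O.valuation (x - y) ≤ O.valuation (f x - f y) ∧
        O.valuation (f x - f y) ≤ μ * O.valuation (((m : ℕ) : K)⁻¹) * O.valuation (x - y)

/-- Property (T2) of `f : K → K`: only finitely many fibres are infinite. -/
def PropertyT2 (f : K → K) : Prop :=
  {y : K | (f ⁻¹' {y}).Infinite}.Finite

/-- 1-h-minimality of a theory of valued fields of characteristic zero: in all models, (T1) and (T2)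
hold for all functions that are definable with parameters from `K ∪ RV_{|n|}`, `n ≥ 1`. -/
def IsOneHMinimal (ι : langVal →ᴸ L) (T : L.Theory) : Prop :=
  ∀ (M : Type w') [Field M] [CharZero M] [L.Structure M] (O : ValuationSubring M),
    IsValuedFieldStructure ι M O → M ⊨ T →
      ∀ (n : ℕ+) (A : Set M) (B : Set (RV O n)) (f : M → M),
        DefinableOver L O A B {x : Fin 2 → M | x 1 = f (x 0)} →
          PropertyT1 L O A B f ∧ PropertyT2 f

end HMinimality

/-! ## Algebraic and definable closure -/

section Closure

variable (L : FirstOrder.Language.{u, v}) {M : Type w} [L.Structure M]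

/-- The algebraic closure: all elements of finite `A`-definable subsets of `M`. -/
def acl (A : Set M) : Set M :=
  {a | ∃ C : Set M, C.Finite ∧ A.Definable₁ L C ∧ a ∈ C}

/-- The definable closure: all elements `a` such that `{a}` is `A`-definable. -/
def dcl (A : Set M) : Set M :=
  {a | A.Definable₁ L {a}}

end Closure

/-! ## Expansions by predicates on products of the `RV_{|n|}` -/

section Expansion

variable {K : Type w} [Field K] [CharZero K]

/-- A predicate on a product of `k` sorts of the form `RV_{|n|}`, `n ≥ 1`. -/
structure RVPredicate (O : ValuationSubring K) (k : ℕ) where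
  level : Fin k → ℕ+
  carrier : Set (∀ i, RV O (level i))

/-- The language with relation symbols `R` and without function symbols. -/
def relLanguage (R : ℕ → Type r) : FirstOrder.Language.{0, r} := ⟨fun _ => Empty, R⟩

/-- The interpretation in `K` of relation symbols by predicates on products of the `RV_{|n|}`. -/
@[reducible]
def rvStructure {O : ValuationSubring K} {R : ℕ → Type r}
    (P : ∀ k, R k → RVPredicate O k) : (relLanguage R).Structure K where
  funMap := fun f _ => nomatch f
  RelMap := fun {k} s x => (fun i => rv O ((P k s).level i) (x i)) ∈ (P k s).carrier

/-- The theory of `K` in the expansion of `L` by the predicates `P`. -/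
def rvExpansionTheory (L : FirstOrder.Language.{u, v}) [L.Structure K] {O : ValuationSubring K}
    {R : ℕ → Type r} (P : ∀ k, R k → RVPredicate O k) : (L.sum (relLanguage R)).Theory :=
  letI := rvStructure P
  (L.sum (relLanguage R)).completeTheory K

end Expansion

end HMin

/-!
The expansion adds a linear order on each `RV_{|n|}`. In it, a finite definable set `C` with at
least two elements always splits into two smaller definable sets, so that its elements are definable:
the elements of `C` do not all have the same leading term `rv_{|#C|}` relative to the average of
`C` (`exists_rv_average_ne`), and those with minimal leading term form a proper non-empty subset
(`exists_splitSentence`, `acl_eq_dcl_of_split`).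

The main point is that 1-h-minimality is preserved by expansions with predicates on products of the
`RV_{|n|}` (`isOneHMinimal_rvExpansion`). It rests on these consequences of (T1) and (T2) in the
original language.

* By (T1) for indicator functions, infinite definable subsets of the field contain balls, so that
  finite members of definable families have bounded cardinality (`uniform_finiteness`). By (T2), a
  definable family of finite sets that is parametrized by leading terms has a finite union
  (`finite_iUnion_rv_of_finite`): for a function on `RV_{|n|}` this is immediate, as its fibres are
  infinite when viewed in the field, and finite sets are encoded by values of polynomials.
* For a definable family of functions that is parametrized by leading terms, compactness yields
  finitely many formulas for the finite sets in (T1). The union of these sets over the whole family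
  is finite, so one finite set, definable without the parameters in `RV_{|n|}`, works for all
  members of the family (`uniform_t1`, `uniform_preparation`).
* Elements of finite definable sets are definable from leading terms (`exists_coding`). Together
  with uniform preparation this shows, by induction on the number of variables, that a definable
  family of sets of tuples of leading terms can be parametrized by leading terms
  (`rv_stablyEmbedded`).

By stable embeddedness, the sets `{a | ∃ b, R a b ∧ Z b}`, where `R` is definable in the original
language and `Z` is an arbitrary predicate on leading terms, are closed under complements. As they
are also closed under intersections and projections, every set that is definable in the expansion is
of this form (`rvDef_of_boundedFormula`). The graph of a definable function `f` of the expansion is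
therefore a union of members of a definable family of graphs of partial functions that is
parametrized by leading terms. On each ball next to a finite set as in `uniform_t1`, the function
`f` agrees with one member of the family, which gives (T1) (`t1_of_family`), and a fibre of `f` is a
union of fibres of the members, which gives (T2) (`t2_of_family`).
-/

namespace HMin

open FirstOrder.Language

universe x

/-! ### Uniformly definable predicates -/

section UniformDefinability

variable {L : FirstOrder.Language.{u, v}}

/-- A model of `T` that is a valued field of characteristic zero. -/
structure VModel (ι : langVal →ᴸ L) (T : L.Theory) where
  carrier : Type x
  [field : Field carrier]
  [charZero : CharZero carrier]
  [struct : L.Structure carrier]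
  O : ValuationSubring carrier
  valued : IsValuedFieldStructure ι carrier O
  models : carrier ⊨ T

attribute [instance] VModel.field VModel.charZero VModel.struct

instance (ι : langVal →ᴸ L) (T : L.Theory) : CoeSort (VModel.{u, v, x} ι T) (Type x) :=
  ⟨VModel.carrier⟩

variable {ι : langVal →ᴸ L} {T : L.Theory}

/-- A predicate on tuples, given in all models at once, is uniformly definable if one formula
without parameters defines it in all models. -/
def UDef {α : Type} (P : ∀ N : VModel.{u, v, x} ι T, (α → N) → Prop) : Prop :=
  ∃ φ : L.Formula α, ∀ (N : VModel.{u, v, x} ι T) (v : α → N), φ.Realize v ↔ P N v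

namespace UDef

variable {α β : Type} {P Q : ∀ N : VModel.{u, v, x} ι T, (α → N) → Prop}

theorem of_formula (φ : L.Formula α) :
    UDef (fun (N : VModel.{u, v, x} ι T) (v : α → N) => φ.Realize v) :=
  ⟨φ, fun _ _ => Iff.rfl⟩

theorem congr (hP : UDef P) (h : ∀ N v, P N v ↔ Q N v) : UDef Q := by
  obtain ⟨φ, hφ⟩ := hP
  exact ⟨φ, fun N v => (hφ N v).trans (h N v)⟩

theorem not (hP : UDef P) : UDef fun N v => ¬ P N v := by
  obtain ⟨φ, hφ⟩ := hP
  exact ⟨φ.not, fun N v => by rw [Formula.realize_not, hφ]⟩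

theorem and (hP : UDef P) (hQ : UDef Q) : UDef fun N v => P N v ∧ Q N v := by
  obtain ⟨φ, hφ⟩ := hP
  obtain ⟨ψ, hψ⟩ := hQ
  exact ⟨φ ⊓ ψ, fun N v => by rw [Formula.realize_inf, hφ, hψ]⟩

theorem or (hP : UDef P) (hQ : UDef Q) : UDef fun N v => P N v ∨ Q N v := by
  refine (hP.not.and hQ.not).not.congr fun N v => ?_
  tauto

theorem imp (hP : UDef P) (hQ : UDef Q) : UDef fun N v => P N v → Q N v := by
  refine (hP.and hQ.not).not.congr fun N v => ?_
  tauto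

theorem iff (hP : UDef P) (hQ : UDef Q) : UDef fun N v => (P N v ↔ Q N v) := by
  refine ((hP.imp hQ).and (hQ.imp hP)).congr fun N v => ?_
  tauto

theorem const (p : Prop) : UDef fun (N : VModel.{u, v, x} ι T) (_ : α → N) => p := by
  by_cases hp : p
  · exact ⟨⊤, fun N v => by simp [hp]⟩
  · exact ⟨⊥, fun N v => by simp [hp]⟩

theorem reindex (hP : UDef P) (f : α → β) : UDef fun N (w : β → N) => P N fun i => w (f i) := by
  obtain ⟨φ, hφ⟩ := hP
  exact ⟨φ.relabel f, fun N v => by rw [Formula.realize_relabel]; exact hφ _ _⟩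

theorem exs [Finite β] {P : ∀ N : VModel.{u, v, x} ι T, (α → N) → (β → N) → Prop}
    (hP : UDef fun N (w : α ⊕ β → N) => P N (fun i => w (.inl i)) (fun i => w (.inr i))) :
    UDef fun N v => ∃ b : β → N, P N v b := by
  obtain ⟨φ, hφ⟩ := hP
  refine ⟨φ.iExs β, fun N v => ?_⟩
  rw [Formula.realize_iExs]
  exact exists_congr fun b => hφ N (Sum.elim v b)

theorem alls [Finite β] {P : ∀ N : VModel.{u, v, x} ι T, (α → N) → (β → N) → Prop}
    (hP : UDef fun N (w : α ⊕ β → N) => P N (fun i => w (.inl i)) (fun i => w (.inr i))) :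
    UDef fun N v => ∀ b : β → N, P N v b := by
  refine (exs (P := fun N v b => ¬ P N v b) hP.not).not.congr fun N v => ?_
  push Not; rfl

theorem ex {P : ∀ N : VModel.{u, v, x} ι T, (α → N) → N → Prop}
    (hP : UDef fun N (w : Option α → N) => P N (fun i => w (some i)) (w none)) :
    UDef fun N v => ∃ y : N, P N v y := by
  refine (exs (β := Unit) (P := fun N v b => P N v (b ())) ?_).congr fun N v => ?_
  · exact hP.reindex (fun o : Option α => (o.elim (Sum.inr ()) Sum.inl : α ⊕ Unit))
  · exact ⟨fun ⟨b, h⟩ => ⟨_, h⟩, fun ⟨y, h⟩ => ⟨fun _ => y, h⟩⟩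

theorem all {P : ∀ N : VModel.{u, v, x} ι T, (α → N) → N → Prop}
    (hP : UDef fun N (w : Option α → N) => P N (fun i => w (some i)) (w none)) :
    UDef fun N v => ∀ y : N, P N v y := by
  refine (ex (P := fun N v b => ¬ P N v b) hP.not).not.congr fun N v => ?_
  push Not; rfl

theorem forall_finite {κ : Type*} [Finite κ] {P : κ → ∀ N : VModel.{u, v, x} ι T, (α → N) → Prop}
    (hP : ∀ i, UDef (P i)) : UDef fun N v => ∀ i, P i N v := by
  choose φ hφ using hP
  exact ⟨Formula.iInf φ, fun N v => by simp [Formula.realize_iInf, hφ]⟩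

theorem exists_finite {κ : Type*} [Finite κ] {P : κ → ∀ N : VModel.{u, v, x} ι T, (α → N) → Prop}
    (hP : ∀ i, UDef (P i)) : UDef fun N v => ∃ i, P i N v := by
  choose φ hφ using hP
  exact ⟨Formula.iSup φ, fun N v => by simp [Formula.realize_iSup, hφ]⟩

end UDef

/-- A function on tuples, given in all models at once, is uniformly definable if its graph is. -/
def UFun {α : Type} (t : ∀ N : VModel.{u, v, x} ι T, (α → N) → N) : Prop :=
  UDef fun N (w : Option α → N) => w none = t N fun i => w (some i)

namespace UFun

variable {α β : Type} {t s : ∀ N : VModel.{u, v, x} ι T, (α → N) → N}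

theorem subst (ht : UFun t) {P : ∀ N : VModel.{u, v, x} ι T, (α → N) → N → Prop}
    (hP : UDef fun N (w : Option α → N) => P N (fun i => w (some i)) (w none)) :
    UDef fun N v => P N v (t N v) := by
  refine (UDef.ex (P := fun N v y => y = t N v ∧ P N v y) (ht.and hP)).congr fun N v => ?_
  simp

theorem reindex (ht : UFun t) (f : α → β) :
    UFun fun N (w : β → N) => t N fun i => w (f i) :=
  UDef.reindex ht (fun o => o.elim none fun i => some (f i))

theorem congr (ht : UFun t) (h : ∀ N v, t N v = s N v) : UFun s :=
  UDef.congr ht fun N v => by rw [h]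

theorem var (i : α) : UFun fun (N : VModel.{u, v, x} ι T) (v : α → N) => v i :=
  ⟨(Term.var none).equal (Term.var (some i)), fun N v => by simp⟩

theorem of_term (t : L.Term α) :
    UFun fun (N : VModel.{u, v, x} ι T) (v : α → N) => t.realize v :=
  ⟨(Term.var none).equal (t.relabel some), fun N v => by
    simp [Function.comp_def]⟩

theorem eq (ht : UFun t) (hs : UFun s) : UDef fun N v => t N v = s N v := by
  refine ht.subst (P := fun N v y => y = s N v) ?_
  exact hs

theorem comp₂ {F : ∀ N : VModel.{u, v, x} ι T, N → N → N}
    (hF : UFun fun N (w : Fin 2 → N) => F N (w 0) (w 1))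
    (ht : UFun t) (hs : UFun s) : UFun fun N v => F N (t N v) (s N v) := by
  unfold UFun
  refine (ht.reindex some).subst (P := fun N v y => v none = F N y (s N fun i => v (some i))) ?_
  refine ((hs.reindex some).reindex some).subst
    (P := fun N v z => v (some none) = F N (v none) z) ?_
  refine (UDef.reindex hF (fun o : Option (Fin 2) =>
    o.elim (some (some none)) ![some none, none])).congr fun N v => ?_
  simp

theorem add (ht : UFun t) (hs : UFun s) : UFun fun N v => t N v + s N v := by
  refine comp₂ (F := fun N a b => a + b) ?_ ht hs
  refine (of_term (Term.func (ι.onFunction (ValFunc.add : langVal.Functions 2))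
    fun i => Term.var i)).congr fun N v => ?_
  rw [← N.valued.map_add]
  simp only [Term.realize]
  congr 1
  funext i; fin_cases i <;> rfl

theorem mul (ht : UFun t) (hs : UFun s) : UFun fun N v => t N v * s N v := by
  refine comp₂ (F := fun N a b => a * b) ?_ ht hs
  refine (of_term (Term.func (ι.onFunction (ValFunc.mul : langVal.Functions 2))
    fun i => Term.var i)).congr fun N v => ?_
  rw [← N.valued.map_mul]
  simp only [Term.realize]
  congr 1
  funext i; fin_cases i <;> rfl

theorem sub (ht : UFun t) (hs : UFun s) : UFun fun N v => t N v - s N v := by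
  refine ((add (var none) (hs.reindex some)).eq (ht.reindex some)).congr fun N v => ?_
  exact eq_sub_iff_add_eq.symm

theorem zero : UFun fun (N : VModel.{u, v, x} ι T) (_ : α → N) => (0 : N) := by
  refine ((add (var none) (var none)).eq (var none)).congr fun N v => ?_
  simp

theorem one : UFun fun (N : VModel.{u, v, x} ι T) (_ : α → N) => (1 : N) := by
  refine (((mul (var none) (var none)).eq (var none)).and
    (eq (var none) zero).not).congr fun N v => ?_
  constructor
  · rintro ⟨h, h0⟩
    exact mul_left_cancel₀ h0 (by rw [h, mul_one])
  · intro h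
    simp [h]

theorem natCast (n : ℕ) : UFun fun (N : VModel.{u, v, x} ι T) (_ : α → N) => (n : N) := by
  induction n with
  | zero => exact zero.congr fun N v => by simp
  | succ n ih => exact (ih.add one).congr fun N v => by simp

theorem sum {n : ℕ} {t : Fin n → ∀ N : VModel.{u, v, x} ι T, (α → N) → N} (h : ∀ i, UFun (t i)) :
    UFun fun N v => ∑ i, t i N v := by
  induction n with
  | zero => exact zero.congr fun N v => by simp
  | succ n ih =>
    exact ((h 0).add (ih fun i => h i.succ)).congr fun N v => by rw [Fin.sum_univ_succ]

theorem prod {n : ℕ} {t : Fin n → ∀ N : VModel.{u, v, x} ι T, (α → N) → N} (h : ∀ i, UFun (t i)) :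
    UFun fun N v => ∏ i, t i N v := by
  induction n with
  | zero => exact one.congr fun N v => by simp
  | succ n ih =>
    exact ((h 0).mul (ih fun i => h i.succ)).congr fun N v => by rw [Fin.prod_univ_succ]

theorem mem_ring (ht : UFun t) : UDef fun N v => t N v ∈ N.O := by
  refine ht.subst (P := fun N v y => y ∈ N.O) ?_
  refine ⟨Relations.formula (ι.onRelation (ValRel.ring : langVal.Relations 1))
    ![Term.var none], fun N v => ?_⟩
  refine Iff.trans ?_ (N.valued.map_ring (v none))
  rw [Formula.realize_rel]
  refine iff_of_eq (congrArg _ ?_)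
  funext i; fin_cases i; rfl

theorem val_le (ht : UFun t) (hs : UFun s) :
    UDef fun N v => N.O.valuation (t N v) ≤ N.O.valuation (s N v) := by
  refine (UDef.ex (P := fun N v z => z ∈ N.O ∧ z * s N v = t N v) ?_).congr fun N v => ?_
  · exact (mem_ring (var none)).and (((var none).mul (hs.reindex some)).eq (ht.reindex some))
  · rw [ValuationSubring.valuation_le_iff]
    exact ⟨fun ⟨z, h, h'⟩ => ⟨⟨z, h⟩, h'⟩, fun ⟨z, h'⟩ => ⟨z, z.2, h'⟩⟩

theorem val_lt (ht : UFun t) (hs : UFun s) :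
    UDef fun N v => N.O.valuation (t N v) < N.O.valuation (s N v) :=
  (val_le hs ht).not.congr fun _ _ => not_le

end UFun

end UniformDefinability

section LeadingTerms

variable {K : Type w} [Field K] [CharZero K] (O : ValuationSubring K)

theorem val_natCast_pos (n : ℕ+) : 0 < O.valuation ((n : ℕ) : K) := by
  simp [zero_lt_iff]

theorem rv_eq_rv_iff (n : ℕ+) (x y : K) :
    rv O n x = rv O n y ↔ x = y ∨ O.valuation (x - y) < O.valuation (((n : ℕ) : K) * y) := by
  by_cases hy : y = 0
  · subst hy
    by_cases hx : x = 0
    · simp [hx]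
    · simp [rv, hx]
  by_cases hx : x = 0
  · subst hx
    have h1 : ¬ (0 = y) := fun h => hy h.symm
    have : O.valuation (((n : ℕ) : K)) * O.valuation y ≤ O.valuation y :=
      mul_le_of_le_one_left' (valuation_natCast_le_one O n)
    simp [rv, hy, h1, this]
  simp only [rv, hx, hy, dite_false, WithZero.coe_inj]
  rw [eq_comm, QuotientGroup.eq]
  change O.valuation (((Units.mk0 y hy)⁻¹ * Units.mk0 x hx : Kˣ) - 1 : K) <
    O.valuation ((n : ℕ) : K) ↔ _
  have e : (((Units.mk0 y hy)⁻¹ * Units.mk0 x hx : Kˣ) - 1 : K) = (x - y) / y := by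
    push_cast
    simp
    field_simp
  have hvy : 0 < O.valuation y := by simp [zero_lt_iff, hy]
  rw [e, map_div₀, div_lt_iff₀ hvy, ← map_mul]
  constructor
  · exact Or.inr
  · rintro (rfl | h)
    · simp [zero_lt_iff, hx]
    · exact h

theorem rv_eq_zero_iff (n : ℕ+) (x : K) : rv O n x = 0 ↔ x = 0 := by
  unfold rv
  split <;> simp_all

theorem rv_surjective (n : ℕ+) : Function.Surjective (rv O n) := by
  intro ξ
  induction ξ using WithZero.recZeroCoe with
  | zero => exact ⟨0, by simp [rv]⟩
  | coe a =>
    obtain ⟨a, rfl⟩ := QuotientGroup.mk_surjective a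
    exact ⟨a, by simp [rv]⟩

omit [CharZero K] in
theorem val_natCast_le_of_dvd {n m : ℕ+} (h : n ∣ m) :
    O.valuation ((m : ℕ) : K) ≤ O.valuation ((n : ℕ) : K) := by
  obtain ⟨k, rfl⟩ := h
  push_cast
  rw [map_mul]
  exact mul_le_of_le_one_right' (valuation_natCast_le_one O k)

theorem rv_eq_of_dvd {n m : ℕ+} (h : n ∣ m) {x y : K} (hxy : rv O m x = rv O m y) :
    rv O n x = rv O n y := by
  rw [rv_eq_rv_iff] at *
  refine hxy.imp_right fun h' => h'.trans_le ?_
  rw [map_mul, map_mul]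
  gcongr
  exact val_natCast_le_of_dvd O h

/-- Componentwise equality of leading terms. -/
def RVEq (n : ℕ+) {β : Type*} (b b' : β → K) : Prop := ∀ i, rv O n (b i) = rv O n (b' i)

variable {O}

theorem RVEq.refl {n : ℕ+} {β : Type*} (b : β → K) : RVEq O n b b := fun _ => rfl

theorem RVEq.symm {n : ℕ+} {β : Type*} {b b' : β → K} (h : RVEq O n b b') : RVEq O n b' b :=
  fun i => (h i).symm

theorem RVEq.trans {n : ℕ+} {β : Type*} {b b' b'' : β → K} (h : RVEq O n b b')
    (h' : RVEq O n b' b'') : RVEq O n b b'' :=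
  fun i => (h i).trans (h' i)

theorem RVEq.of_dvd {n m : ℕ+} (h : n ∣ m) {β : Type*} {b b' : β → K} (hb : RVEq O m b b') :
    RVEq O n b b' := fun i => rv_eq_of_dvd O h (hb i)

end LeadingTerms

section Formulas

variable {L : FirstOrder.Language.{u, v}}

/-- The sum of two terms. -/
def addTerm (ι : langVal →ᴸ L) {α : Type*} (s t : L.Term α) : L.Term α :=
  Term.func (ι.onFunction (ValFunc.add : langVal.Functions 2)) ![s, t]

/-- The product of two terms. -/
def mulTerm (ι : langVal →ᴸ L) {α : Type*} (s t : L.Term α) : L.Term α :=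
  Term.func (ι.onFunction (ValFunc.mul : langVal.Functions 2)) ![s, t]

/-- The term `t + ⋯ + t` with `n + 1` summands. -/
def nsmulTerm (ι : langVal →ᴸ L) {α : Type*} (t : L.Term α) : ℕ → L.Term α
  | 0 => t
  | n + 1 => addTerm ι (nsmulTerm ι t n) t

/-- The formula for `rv_{|n|} x = rv_{|n|} y`: either `x = y`, or there are no `z ∈ O` and `d`
with `d + y = x` and `z * d = n * y`. -/
noncomputable def rvFormula (ι : langVal →ᴸ L) (n : ℕ+) : L.Formula (Fin 2) :=
  ((Term.var 0).equal (Term.var 1)) ⊔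
    (Formula.iExs (Fin 2)
      ((Relations.formula (ι.onRelation (ValRel.ring : langVal.Relations 1))
        ![Term.var (Sum.inr 0)]) ⊓
      ((addTerm ι (Term.var (Sum.inr 1)) (Term.var (Sum.inl 1))).equal (Term.var (Sum.inl 0)) ⊓
      (mulTerm ι (Term.var (Sum.inr 0)) (Term.var (Sum.inr 1))).equal
        (nsmulTerm ι (Term.var (Sum.inl 1)) n.natPred)))).not

variable {K : Type w} [Field K] [L.Structure K] {O : ValuationSubring K} {ι : langVal →ᴸ L}
  (hK : IsValuedFieldStructure ι K O)
include hK

theorem realize_addTerm {α : Type*} (s t : L.Term α) (v : α → K) :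
    (addTerm ι s t).realize v = s.realize v + t.realize v := by
  rw [← hK.map_add]
  simp only [addTerm, Term.realize]
  congr 1
  funext i; fin_cases i <;> rfl

theorem realize_mulTerm {α : Type*} (s t : L.Term α) (v : α → K) :
    (mulTerm ι s t).realize v = s.realize v * t.realize v := by
  rw [← hK.map_mul]
  simp only [mulTerm, Term.realize]
  congr 1
  funext i; fin_cases i <;> rfl

theorem realize_nsmulTerm {α : Type*} (t : L.Term α) (n : ℕ) (v : α → K) :
    (nsmulTerm ι t n).realize v = ((n + 1 : ℕ) : K) * t.realize v := by
  induction n with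
  | zero => simp [nsmulTerm]
  | succ n ih =>
    rw [nsmulTerm, realize_addTerm hK, ih]
    push_cast; ring

theorem realize_rvFormula [CharZero K] (n : ℕ+) (v : Fin 2 → K) :
    (rvFormula ι n).Realize v ↔ rv O n (v 0) = rv O n (v 1) := by
  rw [rv_eq_rv_iff, rvFormula, Formula.realize_sup, Formula.realize_not, Formula.realize_iExs,
    ← not_le, ValuationSubring.valuation_le_iff]
  refine or_congr ?_ (not_congr ?_)
  · simp
  constructor
  · rintro ⟨w, h⟩
    simp only [Formula.realize_inf, Formula.realize_rel, Formula.realize_equal,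
      realize_addTerm hK, realize_mulTerm hK, realize_nsmulTerm hK, Term.realize_var,
      Sum.elim_inl, Sum.elim_inr] at h
    obtain ⟨h1, h2, h3⟩ := h
    refine ⟨⟨w 0, ?_⟩, ?_⟩
    · rw [← hK.map_ring]
      convert! h1 using 2 with i
      fin_cases i; rfl
    · simp only
      rw [← h2, add_sub_cancel_right, h3]
      simp
  · rintro ⟨z, h⟩
    refine ⟨![z, v 0 - v 1], ?_⟩
    simp only [Formula.realize_inf, Formula.realize_rel, Formula.realize_equal,
      realize_addTerm hK, realize_mulTerm hK, realize_nsmulTerm hK, Term.realize_var,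
      Sum.elim_inl, Sum.elim_inr]
    refine ⟨?_, by simp, by simpa using h⟩
    have := (hK.map_ring (z : K)).2 z.2
    convert! this using 2 with i
    fin_cases i; rfl

end Formulas

section UniformDefinability

variable {L : FirstOrder.Language.{u, v}} {ι : langVal →ᴸ L} {T : L.Theory}

theorem UFun.rv_eq {α : Type} {t s : ∀ N : VModel.{u, v, x} ι T, (α → N) → N} (n : ℕ+)
    (ht : UFun t) (hs : UFun s) : UDef fun N v => rv N.O n (t N v) = rv N.O n (s N v) := by
  refine ht.subst (P := fun N v y => rv N.O n y = rv N.O n (s N v)) ?_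
  refine (hs.reindex some).subst (P := fun N v y => rv N.O n (v none) = rv N.O n y) ?_
  refine ((UDef.of_formula (rvFormula ι n)).reindex ![some none, none]).congr fun N v => ?_
  rw [realize_rvFormula N.valued]
  rfl

theorem UDef.rvEq {α β : Type} [Finite β] (n : ℕ+) (f g : β → α) :
    UDef fun (N : VModel.{u, v, x} ι T) (v : α → N) =>
      RVEq N.O n (fun i => v (f i)) (fun i => v (g i)) :=
  UDef.forall_finite fun i => UFun.rv_eq n (UFun.var (f i)) (UFun.var (g i))

end UniformDefinability

/-! ### Ultrapowers and compactness -/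

section Compactness

variable {L : FirstOrder.Language.{u, v}} {ι : langVal →ᴸ L} {T : L.Theory}

section Ultrapower

variable (N : VModel.{u, v, max x w} ι T) {I : Type w} (U : Ultrafilter I)

/-- The carrier of the ultrapower of `N`. -/
abbrev UltraCarrier : Type (max x w) := (U : Filter I).Product fun _ => N.carrier

noncomputable instance UltraCarrier.field : Field (UltraCarrier N U) :=
  inferInstanceAs (Field (Filter.Germ (U : Filter I) N.carrier))

variable {N}

/-- The class of a sequence in the ultrapower. -/
def ultraMk (a : I → N) : UltraCarrier N U :=
  Quotient.mk (Filter.productSetoid (U : Filter I) fun _ => N.carrier) a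

variable {U}

theorem ultraMk_add (a b : I → N) :
    ultraMk U (fun i => a i + b i) = ultraMk U a + ultraMk U b := rfl

theorem ultraMk_mul (a b : I → N) :
    ultraMk U (fun i => a i * b i) = ultraMk U a * ultraMk U b := rfl

theorem ultraMk_natCast (n : ℕ) : ultraMk U (fun _ => (n : N)) = n := rfl

theorem ultraMk_surjective : Function.Surjective (ultraMk U : (I → N) → UltraCarrier N U) :=
  Quotient.mk_surjective

theorem ultraMk_eq (a b : I → N) :
    ultraMk U a = ultraMk U b ↔ ∀ᶠ i in (U : Filter I), a i = b i :=
  Quotient.eq''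

instance UltraCarrier.charZero : CharZero (UltraCarrier N U) where
  cast_injective n m h := by
    rw [← ultraMk_natCast, ← ultraMk_natCast, ultraMk_eq] at h
    obtain ⟨i, hi⟩ := h.exists
    exact_mod_cast hi

/-- Łoś's theorem for formulas in the ultrapower. -/
theorem realize_ultraMk {α : Type*} (φ : L.Formula α) (a : α → I → N) :
    φ.Realize (fun j => ultraMk U (a j)) ↔ ∀ᶠ i in (U : Filter I), φ.Realize fun j => a j i :=
  Ultraproduct.realize_formula_cast φ a

variable (N U)

/-- The predicate for the valuation ring in the ultrapower. -/
def ultraRing (y : UltraCarrier N U) : Prop :=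
  (Relations.formula (ι.onRelation (ValRel.ring : langVal.Relations 1))
    ![Term.var ()]).Realize fun _ : Unit => y

variable {N U}

theorem ultraRing_mk (a : I → N) :
    ultraRing N U (ultraMk U a) ↔ ∀ᶠ i in (U : Filter I), a i ∈ N.O := by
  rw [ultraRing, realize_ultraMk (a := fun _ => a)]
  refine Filter.eventually_congr (Filter.Eventually.of_forall fun i => ?_)
  refine Iff.trans ?_ (N.valued.map_ring (a i))
  rw [Formula.realize_rel]
  refine iff_of_eq (congrArg _ ?_)
  funext i; fin_cases i; rfl

variable (N U)

/-- The valuation ring of the ultrapower. -/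
noncomputable def ultraO : ValuationSubring (UltraCarrier N U) where
  carrier := {y | ultraRing N U y}
  mul_mem' {y z} hy hz := by
    obtain ⟨a, rfl⟩ := ultraMk_surjective y
    obtain ⟨b, rfl⟩ := ultraMk_surjective z
    exact (ultraRing_mk _).2 ((((ultraRing_mk a).1 hy).and ((ultraRing_mk b).1 hz)).mono
      fun i h => mul_mem h.1 h.2)
  add_mem' {y z} hy hz := by
    obtain ⟨a, rfl⟩ := ultraMk_surjective y
    obtain ⟨b, rfl⟩ := ultraMk_surjective z
    exact (ultraRing_mk _).2 ((((ultraRing_mk a).1 hy).and ((ultraRing_mk b).1 hz)).mono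
      fun i h => add_mem h.1 h.2)
  one_mem' := (ultraRing_mk _).2 (Filter.Eventually.of_forall fun i => one_mem _)
  zero_mem' := (ultraRing_mk _).2 (Filter.Eventually.of_forall fun i => zero_mem _)
  neg_mem' {y} hy := by
    obtain ⟨a, rfl⟩ := ultraMk_surjective y
    exact (ultraRing_mk _).2 (((ultraRing_mk a).1 hy).mono fun i h => neg_mem h)
  mem_or_inv_mem' y := by
    obtain ⟨a, rfl⟩ := ultraMk_surjective y
    refine (Ultrafilter.eventually_or.1 (Filter.Eventually.of_forall fun i =>
      N.O.mem_or_inv_mem (a i))).imp (fun h => (ultraRing_mk _).2 h) fun h => (ultraRing_mk _).2 h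

theorem mem_ultraO (a : I → N) :
    ultraMk U a ∈ ultraO N U ↔ ∀ᶠ i in (U : Filter I), a i ∈ N.O := ultraRing_mk a

/-- The ultrapower of a model. -/
noncomputable def VModel.ultrapower : VModel.{u, v, max x w} ι T where
  carrier := UltraCarrier N U
  O := ultraO N U
  valued :=
    { nontrivial := by
        intro h
        refine N.valued.nontrivial (SetLike.ext fun y => ⟨fun _ => trivial, fun _ => ?_⟩)
        have : ultraMk U (fun _ => y) ∈ ultraO N U := h ▸ ValuationSubring.mem_top _
        exact ((mem_ultraO N U _).1 this).exists.choose_spec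
      map_add := fun y z => by
        obtain ⟨a, rfl⟩ := ultraMk_surjective y
        obtain ⟨b, rfl⟩ := ultraMk_surjective z
        rw [← ultraMk_add]
        have h := Ultraproduct.funMap_cast (u := U) (M := fun _ => N.carrier)
          (ι.onFunction (ValFunc.add : langVal.Functions 2)) ![a, b]
        have e : (fun i => ultraMk U ((![a, b] : Fin 2 → I → N) i)) =
            ![ultraMk U a, ultraMk U b] := by
          funext i; fin_cases i <;> rfl
        rw [← e]
        refine h.trans ?_
        refine congrArg (ultraMk U) (funext fun i => ?_)
        rw [← N.valued.map_add]
        congr 1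
        funext j; fin_cases j <;> rfl
      map_mul := fun y z => by
        obtain ⟨a, rfl⟩ := ultraMk_surjective y
        obtain ⟨b, rfl⟩ := ultraMk_surjective z
        rw [← ultraMk_mul]
        have h := Ultraproduct.funMap_cast (u := U) (M := fun _ => N.carrier)
          (ι.onFunction (ValFunc.mul : langVal.Functions 2)) ![a, b]
        have e : (fun i => ultraMk U ((![a, b] : Fin 2 → I → N) i)) =
            ![ultraMk U a, ultraMk U b] := by
          funext i; fin_cases i <;> rfl
        rw [← e]
        refine h.trans ?_
        refine congrArg (ultraMk U) (funext fun i => ?_)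
        rw [← N.valued.map_mul]
        congr 1
        funext j; fin_cases j <;> rfl
      map_ring := fun y => by
        change _ ↔ ultraRing N U y
        rw [ultraRing, Formula.realize_rel]
        refine iff_of_eq (congrArg _ ?_)
        funext i; fin_cases i; rfl }
  models := by
    rw [Theory.model_iff]
    intro φ hφ
    exact (Ultraproduct.sentence_realize φ).2
      (Filter.Eventually.of_forall fun _ => (Theory.model_iff T).1 N.models φ hφ)

end Ultrapower

/-- Compactness: if in every model every tuple satisfies one of the predicates `P j`, then, in a
given model, finitely many of the `P j` suffice. -/
theorem UDef.compactness {J : Type w} {α : Type}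
    {P : J → ∀ N : VModel.{u, v, max x w} ι T, (α → N) → Prop} (hP : ∀ j, UDef (P j))
    (h : ∀ N v, ∃ j, P j N v) (N : VModel.{u, v, max x w} ι T) :
    ∃ s : Finset J, ∀ v : α → N, ∃ j ∈ s, P j N v := by
  classical
  by_contra! hs
  choose a ha using hs
  obtain ⟨j, hj⟩ := h (N.ultrapower (Ultrafilter.of (Filter.atTop : Filter (Finset J))))
    fun i => ultraMk _ fun s => a s i
  obtain ⟨φ, hφ⟩ := hP j
  have h1 := (realize_ultraMk φ (fun i s => a s i)).1 ((hφ _ _).2 hj)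
  have h2 : ∀ᶠ s in (Ultrafilter.of (Filter.atTop : Filter (Finset J)) : Filter (Finset J)),
      ({j} : Finset J) ≤ s :=
    Ultrafilter.of_le _ (Filter.eventually_ge_atTop _)
  obtain ⟨s, hs1, hs2⟩ := (h1.and h2).exists
  exact ha s j (hs2 (Finset.mem_singleton_self j)) ((hφ _ _).1 hs1)

end Compactness

/-! ### Balls and property (T1) -/

section Balls

variable {K : Type w} [Field K] [CharZero K] {O : ValuationSubring K}

/-- The condition of property (T1) on the finite set `C` and the integer `m`. -/
def T1At (O : ValuationSubring K) (C : Set K) (m : ℕ+) (f : K → K) : Prop :=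
  ∀ D : Set K, IsBallNextTo O m C D →
    ∃ μ : O.ValueGroup, ∀ x ∈ D, ∀ y ∈ D,
      μ * O.valuation ((m : ℕ) : K) * O.valuation (x - y) ≤ O.valuation (f x - f y) ∧
      O.valuation (f x - f y) ≤ μ * O.valuation (((m : ℕ) : K)⁻¹) * O.valuation (x - y)

/-- For `x₀ ∉ C`, the point `x` lies in the ball `|m|`-next to `C` that contains `x₀`. -/
def SameBall (O : ValuationSubring K) (m : ℕ+) (C : Set K) (x₀ x : K) : Prop :=
  ∀ c ∈ C, rv O m (x - c) = rv O m (x₀ - c)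

theorem SameBall.mono {m m' : ℕ+} {C C' : Set K} (hC : C ⊆ C') (hm : m ∣ m') {x₀ x : K}
    (h : SameBall O m' C' x₀ x) : SameBall O m C x₀ x :=
  fun c hc => rv_eq_of_dvd O hm (h c (hC hc))

theorem SameBall.refl (m : ℕ+) (C : Set K) (x₀ : K) : SameBall O m C x₀ x₀ := fun _ _ => rfl

/-- Property (T1) without reference to the value group. -/
theorem t1At_iff {C : Set K} {m : ℕ+} {f : K → K} :
    T1At O C m f ↔ ∀ x₀ ∉ C, ∃ z : K, ∀ x y, SameBall O m C x₀ x → SameBall O m C x₀ y →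
      O.valuation (z * (m : ℕ) * (x - y)) ≤ O.valuation (f x - f y) ∧
      O.valuation ((m : ℕ) * (f x - f y)) ≤ O.valuation (z * (x - y)) := by
  have key : ∀ (z a b : K), O.valuation a ≤ O.valuation z * O.valuation (((m : ℕ) : K)⁻¹) *
      O.valuation b ↔ O.valuation ((m : ℕ) * a) ≤ O.valuation (z * b) := by
    intro z a b
    have hm : ((m : ℕ) : K) ≠ 0 := by simp
    rw [← map_mul, ← map_mul]
    have e : z * ((m : ℕ) : K)⁻¹ * b = ((m : ℕ) : K)⁻¹ * (z * b) := by ring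
    rw [e, map_mul, map_inv₀, map_mul O.valuation ((m : ℕ) : K) a,
      le_inv_mul_iff₀ (val_natCast_pos O m)]
  constructor
  · intro h x₀ hx₀
    obtain ⟨μ, hμ⟩ := h {x | SameBall O m C x₀ x} ⟨⟨x₀, SameBall.refl _ _ _⟩,
      fun c => rv O m (x₀ - c), fun c hc h0 => hx₀ (by
        rw [rv_eq_zero_iff, sub_eq_zero] at h0; exact h0 ▸ hc), rfl⟩
    obtain ⟨z, rfl⟩ := O.valuation_surjective μ
    refine ⟨z, fun x y hx hy => ?_⟩
    have := hμ x hx y hy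
    rw [key] at this
    rw [map_mul, map_mul]
    exact this
  · rintro h D ⟨⟨x₀, hx₀⟩, ξ, hξ, rfl⟩
    have hx : x₀ ∉ C := fun hc => hξ _ hc (by rw [← hx₀ _ hc]; simp [rv])
    obtain ⟨z, hz⟩ := h x₀ hx
    refine ⟨O.valuation z, fun x hx y hy => ?_⟩
    rw [key, ← map_mul, ← map_mul]
    exact hz x y (fun c hc => (hx c hc).trans (hx₀ c hc).symm)
      fun c hc => (hy c hc).trans (hx₀ c hc).symm

theorem T1At.mono {C C' : Set K} {m m' : ℕ+} {f : K → K} (h : T1At O C m f) (hC : C ⊆ C')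
    (hm : m ∣ m') : T1At O C' m' f := by
  rw [t1At_iff] at *
  intro x₀ hx₀
  obtain ⟨z, hz⟩ := h x₀ fun h => hx₀ (hC h)
  refine ⟨z, fun x y hx hy => ?_⟩
  obtain ⟨h1, h2⟩ := hz x y (hx.mono hC hm) (hy.mono hC hm)
  have h3 := val_natCast_le_of_dvd O hm
  refine ⟨le_trans ?_ h1, le_trans ?_ h2⟩
  · rw [map_mul, map_mul, map_mul, map_mul]
    gcongr
  · rw [map_mul, map_mul]
    gcongr

variable (O) in
/-- The set `S` contains an open ball. -/
def HasBall (S : Set K) : Prop :=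
  ∃ y r : K, r ≠ 0 ∧ ∀ x, O.valuation (x - y) < O.valuation r → x ∈ S

theorem HasBall.infinite (hO : O ≠ ⊤) {S : Set K} (h : HasBall O S) : S.Infinite := by
  obtain ⟨y, r, hr, hS⟩ := h
  obtain ⟨t, ht⟩ : ∃ t, t ∉ O := by
    by_contra! h
    exact hO (SetLike.ext fun x => ⟨fun _ => trivial, fun _ => h x⟩)
  have ht' : 1 < O.valuation t := by
    rwa [← not_le, ValuationSubring.valuation_le_one_iff]
  have ht0 : t ≠ 0 := by rintro rfl; simp at ht'
  refine Set.infinite_of_injective_forall_mem (f := fun n : ℕ => y + r / t * n) ?_ fun n => ?_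
  · intro n n' h
    have : r / t ≠ 0 := div_ne_zero hr ht0
    simpa [this] using h
  · apply hS
    rw [add_sub_cancel_left, map_mul, map_div₀]
    have h0 : 0 < O.valuation t := lt_trans one_pos ht'
    have hr0 : 0 < O.valuation r := by simp [zero_lt_iff, hr]
    refine (mul_le_of_le_one_right' (valuation_natCast_le_one O n)).trans_lt ?_
    rw [div_lt_iff₀ h0]
    exact lt_mul_of_one_lt_right hr0 ht'

omit [CharZero K] in
theorem HasBall.mono {S S' : Set K} (h : HasBall O S) (hS : S ⊆ S') : HasBall O S' := by
  obtain ⟨y, r, hr, h⟩ := h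
  exact ⟨y, r, hr, fun x hx => hS (h x hx)⟩

theorem hasBall_sameBall {C : Set K} (hC : C.Finite) (m : ℕ+) {x₀ : K} (hx₀ : x₀ ∉ C) :
    HasBall O {x | SameBall O m C x₀ x} := by
  have hm : ((m : ℕ) : K) ≠ 0 := by simp
  rcases C.eq_empty_or_nonempty with rfl | hne
  · exact ⟨0, 1, one_ne_zero, fun x _ c hc => hc.elim⟩
  obtain ⟨c, hc, hmin⟩ := Set.exists_min_image C (fun c => O.valuation (x₀ - c)) hC hne
  refine ⟨x₀, (m : ℕ) * (x₀ - c), mul_ne_zero hm (sub_ne_zero.2 fun h => hx₀ (h ▸ hc)),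
    fun x hx c' hc' => ?_⟩
  rw [rv_eq_rv_iff]
  right
  rw [sub_sub_sub_cancel_right]
  refine hx.trans_le ?_
  rw [map_mul, map_mul]
  gcongr
  exact hmin c' hc'

theorem infinite_rv_fibre (hO : O ≠ ⊤) (n : ℕ+) {b : K} (hb : b ≠ 0) :
    {x | rv O n x = rv O n b}.Infinite := by
  have := (hasBall_sameBall (O := O) (Set.finite_singleton (0 : K)) n (x₀ := b)
    (by simpa using hb)).infinite hO
  refine this.mono fun x hx => ?_
  simpa using hx 0 rfl

open Classical in
/-- The indicator function of `S` with values `0` and `1`. -/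
noncomputable def charFun (S : Set K) (x : K) : K := if x ∈ S then 1 else 0

/-- If (T1) holds for the indicator function of `S`, then each ball `|m|`-next to `C` is contained
in `S` or disjoint from `S`: the ball is infinite, the indicator function takes some value twice on
it, so that its scaling factor is zero. -/
theorem T1At.mem_iff (hO : O ≠ ⊤) {C : Set K} (hC : C.Finite) {m : ℕ+} {S : Set K}
    (h : T1At O C m (charFun S)) {x₀ x : K} (hx₀ : x₀ ∉ C) (hx : SameBall O m C x₀ x) :
    x ∈ S ↔ x₀ ∈ S := by
  obtain ⟨z, hz⟩ := t1At_iff.1 h x₀ hx₀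
  have hm : ((m : ℕ) : K) ≠ 0 := by simp
  obtain ⟨a, ha, b, hb, hab, hf⟩ := ((hasBall_sameBall (O := O) hC m hx₀).infinite
    hO).exists_ne_map_eq_of_mapsTo (f := charFun S) (t := {0, 1}) (by
      intro y _
      by_cases hy : y ∈ S <;> simp [charFun, hy]) (by simp)
  have h1 := (hz a b ha hb).1
  rw [hf, sub_self, map_zero, le_zero_iff, map_eq_zero] at h1
  have hz0 : z = 0 := by simpa [hm, sub_eq_zero, hab] using h1
  have h2 := (hz x x₀ hx (SameBall.refl _ _ _)).2
  rw [hz0, zero_mul, map_zero, le_zero_iff, map_eq_zero] at h2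
  have h3 : charFun S x = charFun S x₀ := by simpa [hm, sub_eq_zero] using h2
  by_cases h4 : x ∈ S <;> by_cases h5 : x₀ ∈ S <;> simp [charFun, h4, h5] at h3 ⊢

theorem T1At.hasBall (hO : O ≠ ⊤) {C : Set K} (hC : C.Finite) {m : ℕ+} {S : Set K}
    (h : T1At O C m (charFun S)) (hS : S.Infinite) : HasBall O S := by
  obtain ⟨x₀, hx₀, hx₀C⟩ := (hS.sdiff hC).nonempty
  exact (hasBall_sameBall hC m hx₀C).mono fun x hx => (h.mem_iff hO hC hx₀C hx).2 hx₀

end Balls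

section Cover

/-- The set `S` has at most `s` elements. -/
def CardLE {K : Type*} (S : Set K) (s : ℕ) : Prop := ∃ c : Fin s → K, ∀ x ∈ S, ∃ i, x = c i

theorem CardLE.finite {K : Type*} {S : Set K} {s : ℕ} (h : CardLE S s) : S.Finite := by
  obtain ⟨c, hc⟩ := h
  exact (Set.finite_range c).subset fun x hx => by
    obtain ⟨i, rfl⟩ := hc x hx
    exact ⟨i, rfl⟩

theorem cardLE_iff {K : Type*} [Nonempty K] {S : Set K} {s : ℕ} :
    CardLE S s ↔ S.Finite ∧ S.ncard ≤ s := by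
  constructor
  · intro h
    refine ⟨h.finite, ?_⟩
    obtain ⟨c, hc⟩ := h
    have : S ⊆ Set.range c := fun x hx => by
      obtain ⟨i, rfl⟩ := hc x hx
      exact ⟨i, rfl⟩
    refine (Set.ncard_le_ncard this (Set.finite_range c)).trans ?_
    rw [← Set.image_univ]
    refine (Set.ncard_image_le Set.finite_univ).trans ?_
    simp
  · rintro ⟨hS, hs⟩
    obtain ⟨n, f, hf⟩ := hS.fin_embedding
    have hn : n = S.ncard := by
      rw [← hf, ← Set.image_univ, Set.ncard_image_of_injective _ f.injective]; simp
    obtain ⟨a⟩ := ‹Nonempty K›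
    refine ⟨fun i => if h : (i : ℕ) < n then f ⟨i, h⟩ else a, fun x hx => ?_⟩
    rw [← hf] at hx
    obtain ⟨i, rfl⟩ := hx
    exact ⟨⟨i, by omega⟩, by simp⟩

end Cover

/-! ### Uniform finiteness and families over leading terms -/

section Polynomials

/-- A finite set is determined by its number `j` of elements and the values at `0, …, j` of the
monic polynomial whose roots are its elements. -/
theorem eq_of_finprod_sub_eq {K : Type*} [Field K] [CharZero K] {S S' : Set K} (hS : S.Finite)
    (hS' : S'.Finite) (hc : S.ncard = S'.ncard)
    (h : ∀ t : ℕ, t ≤ S.ncard → ∏ᶠ y ∈ S, ((t : K) - y) = ∏ᶠ y ∈ S', ((t : K) - y)) : S = S' := by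
  classical
  rw [Set.ncard_eq_toFinset_card S hS, Set.ncard_eq_toFinset_card S' hS'] at hc
  rw [Set.ncard_eq_toFinset_card S hS] at h
  simp only [finprod_mem_eq_finite_toFinset_prod _ hS,
    finprod_mem_eq_finite_toFinset_prod _ hS'] at h
  rw [← hS.toFinset_inj (ht := hS')]
  generalize hS.toFinset = F at *
  generalize hS'.toFinset = F' at *
  have hd : ∀ G : Finset K, (∏ y ∈ G, (Polynomial.X - Polynomial.C y)).degree = (G.card : WithBot ℕ) := by
    intro G
    rw [Polynomial.degree_prod]
    simp
  have key : (∏ y ∈ F, (Polynomial.X - Polynomial.C y)) =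
      ∏ y ∈ F', (Polynomial.X - Polynomial.C y) := by
    refine Polynomial.eq_of_degrees_lt_of_eval_index_eq (Finset.range (F.card + 1))
      (v := fun t : ℕ => (t : K)) (fun a _ b _ hab => Nat.cast_injective hab) ?_ ?_ ?_
    · rw [hd, Finset.card_range]
      exact_mod_cast Nat.lt_succ_self _
    · rw [hd, Finset.card_range, ← hc]
      exact_mod_cast Nat.lt_succ_self _
    · intro t ht
      have := h t (by simpa [Nat.lt_succ_iff] using ht)
      simpa [Polynomial.eval_prod] using this
  have := congrArg Polynomial.roots key
  rw [Polynomial.roots_prod_X_sub_C, Polynomial.roots_prod_X_sub_C] at this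
  exact Finset.val_injective this

theorem ncard_eq_iff_exists_enum {K : Type*} {S : Set K} (hS : S.Finite) {j : ℕ} :
    S.ncard = j ↔ ∃ c : Fin j → K, Function.Injective c ∧ ∀ y, y ∈ S ↔ ∃ i, y = c i := by
  constructor
  · intro h
    obtain ⟨n, f, hf, hr⟩ := hS.fin_param
    have hn : n = j := by
      rw [← h, ← hr, ← Set.image_univ, Set.ncard_image_of_injective _ hf]; simp
    subst hn
    exact ⟨f, hf, fun y => by rw [← hr]; simp [eq_comm]⟩
  · rintro ⟨c, hc, hr⟩
    have : S = Set.range c := by ext y; rw [hr]; simp [eq_comm]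
    rw [this, ← Set.image_univ, Set.ncard_image_of_injective _ hc]; simp

theorem finprod_mem_eq_of_enum {K : Type*} [Field K] {S : Set K} {j : ℕ} {c : Fin j → K}
    (hc : Function.Injective c) (hS : ∀ y, y ∈ S ↔ ∃ i, y = c i) (g : K → K) :
    ∏ᶠ y ∈ S, g y = ∏ i, g (c i) := by
  have : S = Set.range c := by ext y; rw [hS]; simp [eq_comm]
  rw [this, finprod_mem_range hc, finprod_eq_prod_of_fintype]

end Polynomials

section HMinimal

variable {L : FirstOrder.Language.{u, v}} {ι : langVal →ᴸ L} {T : L.Theory} {α β : Type}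

theorem UDef.hasBall {P : ∀ N : VModel.{u, v, x} ι T, (α → N) → N → Prop}
    (hP : UDef fun N (w : Option α → N) => P N (fun i => w (some i)) (w none)) :
    UDef fun N v => HasBall N.O {y | P N v y} := by
  refine UDef.ex (P := fun N v y => ∃ r : N, r ≠ 0 ∧
    ∀ x, N.O.valuation (x - y) < N.O.valuation r → P N v x) ?_
  refine UDef.ex (P := fun N (v : Option α → N) r => r ≠ 0 ∧
    ∀ x, N.O.valuation (x - v none) < N.O.valuation r → P N (fun i => v (some i)) x) ?_
  refine ((UFun.var none).eq UFun.zero).not.and ?_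
  refine UDef.all (P := fun N (v : Option (Option α) → N) x =>
    N.O.valuation (x - v (some none)) < N.O.valuation (v none) →
      P N (fun i => v (some (some i))) x) ?_
  exact (((UFun.var _).sub (UFun.var _)).val_lt (UFun.var _)).imp
    (hP.reindex fun o : Option α => o.elim none fun i => some (some (some i)))

theorem UDef.cardLE {P : ∀ N : VModel.{u, v, x} ι T, (α → N) → N → Prop}
    (hP : UDef fun N (w : Option α → N) => P N (fun i => w (some i)) (w none)) (s : ℕ) :
    UDef fun N v => CardLE {y | P N v y} s := by
  refine UDef.exs (P := fun N v (c : Fin s → N) => ∀ y, P N v y → ∃ i, y = c i) ?_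
  refine UDef.all (P := fun N (v : α ⊕ Fin s → N) y =>
    P N (fun i => v (Sum.inl i)) y → ∃ i, y = v (Sum.inr i)) ?_
  exact (hP.reindex fun o : Option α => o.elim none fun i => some (Sum.inl i)).imp
    (UDef.exists_finite fun i => (UFun.var _).eq (UFun.var _))

theorem definable_of_uDef {P : ∀ N : VModel.{u, v, x} ι T, (α ⊕ β → N) → Prop} (hP : UDef P)
    (N : VModel.{u, v, x} ι T) (a : α → N) :
    (Set.range a).Definable L {v : β → N | P N (Sum.elim a v)} := by
  obtain ⟨φ, hφ⟩ := hP
  rw [Set.definable_iff_exists_formula_sum]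
  refine ⟨φ.relabel (Sum.map (fun i => ⟨a i, i, rfl⟩) id), ?_⟩
  ext v
  change P N _ ↔ Formula.Realize _ _
  rw [Formula.realize_relabel, ← hφ]
  refine iff_of_eq (congrArg _ ?_)
  funext i
  rcases i with i | i <;> rfl

variable (hmin : IsOneHMinimal.{u, v, x} ι T)
include hmin

/-- Properties (T1) and (T2) for functions that are definable with parameters from the field. -/
theorem t1_t2_of_uDef {G : ∀ N : VModel.{u, v, x} ι T, (α → N) → N → N → Prop}
    (hG : UDef fun N (w : Option (Option α) → N) =>
      G N (fun i => w (some (some i))) (w (some none)) (w none))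
    (N : VModel.{u, v, x} ι T) (a : α → N) (f : N → N) (hf : ∀ y z, G N a y z ↔ z = f y) :
    (∃ (C : Set N) (m : ℕ+), C.Finite ∧ T1At N.O C m f) ∧ PropertyT2 f := by
  have hd : DefinableOver L N.O (n := 1) (Set.range a) ∅ {x : Fin 2 → N | x 1 = f (x 0)} := by
    refine ⟨0, Fin.elim0, {v | G N a (v (Sum.inr 0)) (v (Sum.inr 1))}, fun i => i.elim0, ?_, ?_⟩
    · exact definable_of_uDef (P := fun N (w : α ⊕ (Fin 0 ⊕ Fin 2) → N) =>
        G N (fun i => w (Sum.inl i)) (w (Sum.inr (Sum.inr 0))) (w (Sum.inr (Sum.inr 1))))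
        (hG.reindex fun o : Option (Option α) => o.elim (Sum.inr (Sum.inr 1))
          fun o => o.elim (Sum.inr (Sum.inr 0)) Sum.inl) N a
    · intro b _
      ext v
      exact (hf _ _).symm
  obtain ⟨⟨C, m, h1, -, -, h2⟩, h3⟩ := hmin N N.O N.valued N.models 1 (Set.range a) ∅ f hd
  exact ⟨⟨C, m, h1, h2⟩, h3⟩

/-- Infinite definable sets contain balls. -/
theorem hasBall_of_infinite {P : ∀ N : VModel.{u, v, x} ι T, (α → N) → N → Prop}
    (hP : UDef fun N (w : Option α → N) => P N (fun i => w (some i)) (w none))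
    (N : VModel.{u, v, x} ι T) (a : α → N) (h : {y | P N a y}.Infinite) :
    HasBall N.O {y | P N a y} := by
  obtain ⟨⟨C, m, hC, hT⟩, -⟩ := t1_t2_of_uDef hmin
    (G := fun N a y z => (P N a y ∧ z = 1) ∨ (¬ P N a y ∧ z = 0)) (by
      have := hP.reindex fun o : Option α => o.elim (some none) fun i => some (some i)
      exact (this.and ((UFun.var _).eq UFun.one)).or (this.not.and ((UFun.var _).eq UFun.zero)))
    N a (charFun {y | P N a y}) (fun y z => by
      by_cases hy : P N a y <;> simp [charFun, hy])
  exact hT.hasBall N.valued.nontrivial hC h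

/-- Uniform finiteness: in a definable family, the finite members have bounded cardinality. -/
theorem uniform_finiteness {P : ∀ N : VModel.{u, v, x} ι T, (α → N) → N → Prop}
    (hP : UDef fun N (w : Option α → N) => P N (fun i => w (some i)) (w none))
    (N : VModel.{u, v, x} ι T) :
    ∃ s, ∀ a : α → N, {y | P N a y}.Finite → CardLE {y | P N a y} s := by
  obtain ⟨F, hF⟩ := UDef.compactness.{u, v, 0, x} (J := Option ℕ)
    (P := fun j (N : VModel.{u, v, x} ι T) (a : α → N) =>
      (j.elim (HasBall N.O {y | P N a y}) fun s => CardLE {y | P N a y} s : Prop)) (by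
      rintro (_ | s)
      · exact hP.hasBall
      · exact hP.cardLE s) (fun N a => by
      by_cases h : {y | P N a y}.Finite
      · exact ⟨some _, cardLE_iff.2 ⟨h, le_rfl⟩⟩
      · exact ⟨none, hasBall_of_infinite hmin hP N a h⟩) N
  refine ⟨F.sup fun j => j.elim 0 id, fun a ha => ?_⟩
  obtain ⟨j, hj, h⟩ := hF a
  rcases j with _ | s
  · exact (h.infinite N.valued.nontrivial ha).elim
  · have hs := (cardLE_iff.1 (show CardLE {y | P N a y} s from h)).2
    exact cardLE_iff.2 ⟨ha, hs.trans (Finset.le_sup (f := fun j : Option ℕ => j.elim 0 id) hj)⟩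

/-- The union of a definable family of finite sets that is parametrized by `RV_{|n|}` is finite. If
the family has members with `j` elements only, then the values at integers of the monic polynomials
with these roots are finitely many by (T2), as they are constant on the fibres of `rv_{|n|}`. -/
theorem finite_iUnion_rv {P : ∀ N : VModel.{u, v, x} ι T, (α → N) → N → N → Prop}
    (hP : UDef fun N (w : Option (Option α) → N) =>
      P N (fun i => w (some (some i))) (w (some none)) (w none))
    (N : VModel.{u, v, x} ι T) (a : α → N) (n : ℕ+)
    (hinv : ∀ b b', rv N.O n b = rv N.O n b' → ∀ y, P N a b y → P N a b' y)
    (hfin : ∀ b, {y | P N a b y}.Finite) : {y | ∃ b, P N a b y}.Finite := by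
  classical
  obtain ⟨s, hs⟩ := uniform_finiteness hmin
    (P := fun N (w : Option α → N) y => P N (fun i => w (some i)) (w none) y) hP N
  set X : N → Set N := fun b => {y | P N a b y} with hX
  have hXs : ∀ b, (X b).ncard ≤ s := fun b =>
    (cardLE_iff.1 (hs (fun o => o.elim b a) (hfin b))).2
  have hXinv : ∀ b b', rv N.O n b = rv N.O n b' → X b = X b' := fun b b' h => by
    ext y; exact ⟨hinv b b' h y, hinv b' b h.symm y⟩
  let h : ℕ → ℕ → N → N := fun j t b =>
    if (X b).ncard = j then ∏ᶠ y ∈ X b, ((t : N) - y) else 0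
  have hrange : ∀ j t, (Set.range (h j t)).Finite := by
    intro j t
    have hT2 : PropertyT2 (h j t) := by
      refine (t1_t2_of_uDef hmin (G := fun N a b z =>
        (∃ c : Fin j → N, (∀ i i', c i = c i' → i = i') ∧ (∀ y, P N a b y ↔ ∃ i, y = c i) ∧
          z = ∏ i, ((t : N) - c i)) ∨ ((¬ ∃ c : Fin j → N, (∀ i i', c i = c i' → i = i') ∧
          (∀ y, P N a b y ↔ ∃ i, y = c i)) ∧ z = 0)) ?_ N a (h j t) ?_).2
      · have h1 : UDef fun (N : VModel.{u, v, x} ι T) (w : Option (Option α) ⊕ Fin j → N) =>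
            ∀ i i', w (Sum.inr i) = w (Sum.inr i') → i = i' :=
          UDef.forall_finite fun i => UDef.forall_finite fun i' =>
            ((UFun.var _).eq (UFun.var _)).imp (UDef.const _)
        have h2 : UDef fun (N : VModel.{u, v, x} ι T) (w : Option (Option α) ⊕ Fin j → N) =>
            ∀ y, P N (fun i => w (Sum.inl (some (some i)))) (w (Sum.inl (some none))) y ↔
              ∃ i, y = w (Sum.inr i) :=
          UDef.all (P := fun N (w : Option (Option α) ⊕ Fin j → N) y =>
            P N (fun i => w (Sum.inl (some (some i)))) (w (Sum.inl (some none))) y ↔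
              ∃ i, y = w (Sum.inr i))
            ((hP.reindex fun o : Option (Option α) => o.elim none
              fun o => o.elim (some (Sum.inl (some none)))
                fun i => some (Sum.inl (some (some i)))).iff
              (UDef.exists_finite fun i => (UFun.var _).eq (UFun.var _)))
        refine UDef.or ?_ (UDef.and (UDef.not ?_) ((UFun.var _).eq UFun.zero))
        · refine UDef.exs (P := fun N (w : Option (Option α) → N) (c : Fin j → N) =>
            (∀ i i', c i = c i' → i = i') ∧
            (∀ y, P N (fun i => w (some (some i))) (w (some none)) y ↔ ∃ i, y = c i) ∧
            w none = ∏ i, ((t : N) - c i)) ?_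
          exact h1.and (h2.and ((UFun.var _).eq
            (UFun.prod fun i => (UFun.natCast t).sub (UFun.var _))))
        · exact UDef.exs (P := fun N (w : Option (Option α) → N) (c : Fin j → N) =>
            (∀ i i', c i = c i' → i = i') ∧
            (∀ y, P N (fun i => w (some (some i))) (w (some none)) y ↔ ∃ i, y = c i))
            (h1.and h2)
      · intro b z
        have e := ncard_eq_iff_exists_enum (hfin b) (j := j)
        by_cases hj : (X b).ncard = j
        · obtain ⟨c, hc, hcX⟩ := e.1 hj
          have hval : h j t b = ∏ᶠ y ∈ X b, ((t : N) - y) := if_pos hj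
          rw [hval]
          constructor
          · rintro (⟨c', hc', hcX', rfl⟩ | ⟨hno, -⟩)
            · exact (finprod_mem_eq_of_enum hc' hcX' _).symm
            · exact (hno ⟨c, hc, hcX⟩).elim
          · rintro rfl
            exact Or.inl ⟨c, hc, hcX, finprod_mem_eq_of_enum hc hcX _⟩
        · have hval : h j t b = 0 := if_neg hj
          rw [hval]
          constructor
          · rintro (⟨c', hc', hcX', rfl⟩ | ⟨-, hz⟩)
            · exact (hj (e.2 ⟨c', hc', hcX'⟩)).elim
            · exact hz
          · intro hz
            exact Or.inr ⟨fun ⟨c, hc, hcX⟩ => hj (e.2 ⟨c, hc, hcX⟩), hz⟩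
    refine (Set.Finite.union hT2 (Set.finite_singleton (h j t 0))).subset ?_
    rintro _ ⟨b, rfl⟩
    by_cases hb : b = 0
    · right; rw [hb]; rfl
    · left
      refine (infinite_rv_fibre N.valued.nontrivial n hb).mono fun b' hb' => ?_
      have : X b' = X b := hXinv _ _ hb'
      change h j t b' = h j t b
      simp only [h, this]
  let Φ : N → (Fin (s + 1) × (Fin (s + 1) → Fin (s + 1) → N)) := fun b =>
    (⟨(X b).ncard, Nat.lt_succ_of_le (hXs b)⟩, fun j t => h j t b)
  have hΦ : (Set.range Φ).Finite := by
    refine ((Set.finite_univ (α := Fin (s + 1))).prod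
      (Set.Finite.pi' fun j : Fin (s + 1) => Set.Finite.pi' fun t : Fin (s + 1) =>
        hrange j t)).subset ?_
    rintro _ ⟨b, rfl⟩
    exact ⟨Set.mem_univ _, fun j t => ⟨b, rfl⟩⟩
  have hfac : ∀ b b', Φ b = Φ b' → X b = X b' := by
    intro b b' hb
    have h1 : (X b).ncard = (X b').ncard := by
      have := congrArg (fun p => (p.1 : ℕ)) hb
      exact this
    refine eq_of_finprod_sub_eq (hfin b) (hfin b') h1 fun t ht => ?_
    have h2 := congrFun (congrFun (congrArg Prod.snd hb)
      ⟨(X b).ncard, Nat.lt_succ_of_le (hXs b)⟩) ⟨t, Nat.lt_succ_of_le (ht.trans (hXs b))⟩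
    simpa [Φ, h, h1] using h2
  have hrX : (Set.range X).Finite := by
    choose! g hg using fun p (hp : p ∈ Set.range Φ) => hp
    refine (hΦ.image fun p => X (g p)).subset ?_
    rintro _ ⟨b, rfl⟩
    exact ⟨Φ b, ⟨b, rfl⟩, hfac _ _ (hg (Φ b) ⟨b, rfl⟩)⟩
  refine (hrX.sUnion ?_).subset ?_
  · rintro _ ⟨b, rfl⟩
    exact hfin b
  · rintro y ⟨b, hb⟩
    exact ⟨X b, ⟨b, rfl⟩, hb⟩

end HMinimal

/-! ### Families over several leading terms -/

section Preparation

variable {L : FirstOrder.Language.{u, v}} {ι : langVal →ᴸ L} {T : L.Theory} {α β : Type}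

theorem UDef.sameBall {P : ∀ N : VModel.{u, v, x} ι T, (α → N) → N → Prop}
    (hP : UDef fun N (w : Option α → N) => P N (fun i => w (some i)) (w none)) (m : ℕ+)
    {t s : ∀ N : VModel.{u, v, x} ι T, (α → N) → N} (ht : UFun t) (hs : UFun s) :
    UDef fun N v => SameBall N.O m {c | P N v c} (t N v) (s N v) := by
  refine UDef.all (P := fun N v c => P N v c → rv N.O m (s N v - c) = rv N.O m (t N v - c)) ?_
  exact hP.imp (UFun.rv_eq m ((hs.reindex some).sub (UFun.var none))
    ((ht.reindex some).sub (UFun.var none)))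

/-- The union of a definable family of finite sets that is parametrized by a power of `RV_{|n|}` is
finite. -/
theorem finite_iUnion_rv_of_finite (hmin : IsOneHMinimal.{u, v, x} ι T) (β : Type) [Finite β]
    {P : ∀ N : VModel.{u, v, x} ι T, (α → N) → (β → N) → N → Prop}
    (hP : UDef fun N (w : Option (α ⊕ β) → N) =>
      P N (fun i => w (some (Sum.inl i))) (fun i => w (some (Sum.inr i))) (w none))
    (N : VModel.{u, v, x} ι T) (a : α → N) (n : ℕ+)
    (hinv : ∀ b b', RVEq N.O n b b' → ∀ y, P N a b y → P N a b' y)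
    (hfin : ∀ b, {y | P N a b y}.Finite) : {y | ∃ b, P N a b y}.Finite := by
  revert P
  refine Finite.induction_empty_option (P := fun β => ∀ {P : ∀ N : VModel.{u, v, x} ι T,
    (α → N) → (β → N) → N → Prop}, (UDef fun N (w : Option (α ⊕ β) → N) =>
      P N (fun i => w (some (Sum.inl i))) (fun i => w (some (Sum.inr i))) (w none)) →
    (∀ b b', RVEq N.O n b b' → ∀ y, P N a b y → P N a b' y) →
    (∀ b, {y | P N a b y}.Finite) → {y | ∃ b, P N a b y}.Finite) ?_ ?_ ?_ β
  · intro β β' e ih P hP hinv hfin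
    refine (ih (P := fun N a b y => P N a (fun i => b (e.symm i)) y)
      (hP.reindex fun o => o.elim none
        (Sum.elim (fun i => some (Sum.inl i)) fun i => some (Sum.inr (e.symm i))))
      (fun b b' h => hinv _ _ fun i => h _) (fun b => hfin _)).subset ?_
    rintro y ⟨b, hb⟩
    exact ⟨fun i => b (e i), by simpa using hb⟩
  · intro P _ _ hfin
    refine (hfin fun i => i.elim).subset ?_
    rintro y ⟨b, hb⟩
    have : b = fun i => i.elim := funext fun i => i.elim
    exact this ▸ hb
  · intro β _ ih P hP hinv hfin
    refine (ih (P := fun N a b y => ∃ t, P N a (fun o => o.elim t b) y) ?_ ?_ ?_).subset ?_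
    · refine UDef.ex (P := fun N (w : Option (α ⊕ β) → N) t => P N (fun i => w (some (Sum.inl i)))
        (fun o => o.elim t fun i => w (some (Sum.inr i))) (w none)) ?_
      refine (hP.reindex fun o => o.elim (some none) (Sum.elim (fun i => some (some (Sum.inl i)))
        fun o => o.elim none fun i => some (some (Sum.inr i)))).congr fun N w => ?_
      refine iff_of_eq (congrArg (fun f => P N _ f _) (funext fun o => ?_))
      rcases o with _ | i <;> rfl
    · rintro b b' h y ⟨t, ht⟩
      refine ⟨t, hinv _ _ (fun o => ?_) y ht⟩
      rcases o with _ | i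
      · rfl
      · exact h i
    · intro b
      refine finite_iUnion_rv hmin (α := α ⊕ β) (P := fun N c t y => P N (fun i => c (Sum.inl i))
        (fun o => o.elim t fun i => c (Sum.inr i)) y) ?_ N (Sum.elim a b) n ?_ ?_
      · refine (hP.reindex fun o => o.elim none (Sum.elim (fun i => some (some (Sum.inl i)))
          fun o => o.elim (some none) fun i => some (some (Sum.inr i)))).congr fun N w => ?_
        refine iff_of_eq (congrArg (fun f => P N _ f _) (funext fun o => ?_))
        rcases o with _ | i <;> rfl
      · intro t t' ht y
        refine hinv _ _ (fun o => ?_) y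
        rcases o with _ | i
        · exact ht
        · rfl
      · intro t
        exact hfin _
    · rintro y ⟨b, hb⟩
      refine ⟨fun i => b (some i), b none, ?_⟩
      convert hb using 1
      funext o
      rcases o with _ | i <;> rfl

section Uniform

variable [Finite β]

/-- The fibre `G a b` is the graph of a function, and it only depends on the leading terms of
`b`. -/
def GoodFibre {N : VModel.{u, v, x} ι T} (n : ℕ+)
    (G : (α → N) → (β → N) → N → N → Prop) (a : α → N) (b : β → N) : Prop :=
  (∀ y, ∃ z, G a b y z) ∧ (∀ y z z', G a b y z → G a b y z' → z = z') ∧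
    ∀ b', RVEq N.O n b b' → ∀ y z, G a b y z ↔ G a b' y z

/-- The set that `ψ` defines over `a` and `b`. -/
def fibreSet {N : VModel.{u, v, x} ι T} (ψ : L.Formula (Option (α ⊕ β))) (a : α → N) (b : β → N) :
    Set N :=
  {y | ψ.Realize fun o => o.elim y (Sum.elim a b)}

/-- The set that `ψ` defines over `a` and `b` has at most `s` elements, only depends on the leading
terms of `b`, and satisfies (T1) with the integer `m` for the function with graph `G a b`. -/
def Witness {N : VModel.{u, v, x} ι T} (n : ℕ+) (G : (α → N) → (β → N) → N → N → Prop)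
    (j : L.Formula (Option (α ⊕ β)) × ℕ+ × ℕ) (a : α → N) (b : β → N) : Prop :=
  CardLE (fibreSet j.1 a b) j.2.2 ∧
  (∀ b', RVEq N.O n b b' → ∀ y, y ∈ fibreSet j.1 a b ↔ y ∈ fibreSet j.1 a b') ∧
  ∀ x₀ ∉ fibreSet j.1 a b, ∃ z : N, ∀ q : Fin 4 → N,
    SameBall N.O j.2.1 (fibreSet j.1 a b) x₀ (q 0) → SameBall N.O j.2.1 (fibreSet j.1 a b) x₀ (q 1) →
    G a b (q 0) (q 2) → G a b (q 1) (q 3) →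
      N.O.valuation (z * (j.2.1 : ℕ) * (q 0 - q 1)) ≤ N.O.valuation (q 2 - q 3) ∧
      N.O.valuation ((j.2.1 : ℕ) * (q 2 - q 3)) ≤ N.O.valuation (z * (q 0 - q 1))

variable {G : ∀ N : VModel.{u, v, x} ι T, (α → N) → (β → N) → N → N → Prop}
  (hG : UDef fun N (w : Option (Option (α ⊕ β)) → N) =>
    G N (fun i => w (some (some (Sum.inl i)))) (fun i => w (some (some (Sum.inr i))))
      (w (some none)) (w none))

include hG in
theorem UDef.goodFibre (n : ℕ+) : UDef fun N (w : α ⊕ β → N) =>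
    GoodFibre n (G N) (fun i => w (Sum.inl i)) (fun i => w (Sum.inr i)) := by
  refine UDef.and ?_ (UDef.and ?_ ?_)
  · refine UDef.all (P := fun N (w : α ⊕ β → N) y => ∃ z, G N (fun i => w (Sum.inl i))
      (fun i => w (Sum.inr i)) y z) ?_
    exact UDef.ex (P := fun N (w : Option (α ⊕ β) → N) z => G N (fun i => w (some (Sum.inl i)))
      (fun i => w (some (Sum.inr i))) (w none) z) hG
  · refine (UDef.alls (P := fun N (w : α ⊕ β → N) (q : Fin 3 → N) =>
      G N (fun i => w (Sum.inl i)) (fun i => w (Sum.inr i)) (q 0) (q 1) →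
      G N (fun i => w (Sum.inl i)) (fun i => w (Sum.inr i)) (q 0) (q 2) → q 1 = q 2) ?_).congr
        fun N w => ?_
    · have h1 : ∀ j : Fin 3, UDef fun N (w : (α ⊕ β) ⊕ Fin 3 → N) =>
          G N (fun i => w (Sum.inl (Sum.inl i))) (fun i => w (Sum.inl (Sum.inr i)))
            (w (Sum.inr 0)) (w (Sum.inr j)) := fun j =>
        hG.reindex fun o => o.elim (Sum.inr j) fun o => o.elim (Sum.inr 0) Sum.inl
      exact (h1 1).imp ((h1 2).imp ((UFun.var _).eq (UFun.var _)))
    · exact ⟨fun h y z z' => h ![y, z, z'], fun h q => h _ _ _⟩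
  · refine UDef.alls (P := fun N (w : α ⊕ β → N) (b' : β → N) =>
      RVEq N.O n (fun i => w (Sum.inr i)) b' → ∀ y z,
        G N (fun i => w (Sum.inl i)) (fun i => w (Sum.inr i)) y z ↔
        G N (fun i => w (Sum.inl i)) b' y z) ?_
    refine (UDef.rvEq n _ _).imp ?_
    refine UDef.all (P := fun N (w : (α ⊕ β) ⊕ β → N) y => ∀ z,
        G N (fun i => w (Sum.inl (Sum.inl i))) (fun i => w (Sum.inl (Sum.inr i))) y z ↔
        G N (fun i => w (Sum.inl (Sum.inl i))) (fun i => w (Sum.inr i)) y z) ?_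
    refine UDef.all (P := fun N (w : Option ((α ⊕ β) ⊕ β) → N) z =>
        G N (fun i => w (some (Sum.inl (Sum.inl i)))) (fun i => w (some (Sum.inl (Sum.inr i))))
          (w none) z ↔
        G N (fun i => w (some (Sum.inl (Sum.inl i)))) (fun i => w (some (Sum.inr i)))
          (w none) z) ?_
    exact (hG.reindex fun o => o.elim none fun o => o.elim (some none)
        fun i => some (some (Sum.inl i))).iff
      (hG.reindex fun o => o.elim none fun o => o.elim (some none)
        (Sum.elim (fun i => some (some (Sum.inl (Sum.inl i)))) fun i => some (some (Sum.inr i))))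

omit [Finite β] in
theorem UDef.mem_fibreSet (ψ : L.Formula (Option (α ⊕ β))) :
    UDef fun (N : VModel.{u, v, x} ι T) (w : Option (α ⊕ β) → N) => w none ∈
      fibreSet ψ (fun i => w (some (Sum.inl i))) (fun i => w (some (Sum.inr i))) := by
  refine (UDef.of_formula ψ).congr fun N w => iff_of_eq (congrArg _ (funext fun o => ?_))
  rcases o with _ | i | i <;> rfl

include hG in
theorem UDef.witness (n : ℕ+) (j : L.Formula (Option (α ⊕ β)) × ℕ+ × ℕ) :
    UDef fun N (w : α ⊕ β → N) =>
      Witness n (G N) j (fun i => w (Sum.inl i)) (fun i => w (Sum.inr i)) := by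
  obtain ⟨ψ, m, s⟩ := j
  have hψ := UDef.mem_fibreSet (ι := ι) (T := T) ψ
  refine UDef.and ?_ (UDef.and ?_ ?_)
  · exact hψ.cardLE (P := fun N (w : α ⊕ β → N) y => y ∈
      fibreSet ψ (fun i => w (Sum.inl i)) (fun i => w (Sum.inr i))) s
  · refine UDef.alls (P := fun N (w : α ⊕ β → N) (b' : β → N) =>
      RVEq N.O n (fun i => w (Sum.inr i)) b' → ∀ y,
        y ∈ fibreSet ψ (fun i => w (Sum.inl i)) (fun i => w (Sum.inr i)) ↔
        y ∈ fibreSet ψ (fun i => w (Sum.inl i)) b') ?_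
    refine (UDef.rvEq n _ _).imp ?_
    refine UDef.all (P := fun N (w : (α ⊕ β) ⊕ β → N) y =>
        y ∈ fibreSet ψ (fun i => w (Sum.inl (Sum.inl i))) (fun i => w (Sum.inl (Sum.inr i))) ↔
        y ∈ fibreSet ψ (fun i => w (Sum.inl (Sum.inl i))) (fun i => w (Sum.inr i))) ?_
    exact (hψ.reindex fun o => o.elim none fun i => some (Sum.inl i)).iff
      (hψ.reindex fun o => o.elim none
        (Sum.elim (fun i => some (Sum.inl (Sum.inl i))) fun i => some (Sum.inr i)))
  · refine UDef.all (P := fun N (w : α ⊕ β → N) x₀ =>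
      x₀ ∉ fibreSet ψ (fun i => w (Sum.inl i)) (fun i => w (Sum.inr i)) →
      ∃ z : N, ∀ q : Fin 4 → N,
        SameBall N.O m (fibreSet ψ (fun i => w (Sum.inl i)) (fun i => w (Sum.inr i))) x₀ (q 0) →
        SameBall N.O m (fibreSet ψ (fun i => w (Sum.inl i)) (fun i => w (Sum.inr i))) x₀ (q 1) →
        G N (fun i => w (Sum.inl i)) (fun i => w (Sum.inr i)) (q 0) (q 2) →
        G N (fun i => w (Sum.inl i)) (fun i => w (Sum.inr i)) (q 1) (q 3) →
        N.O.valuation (z * (m : ℕ) * (q 0 - q 1)) ≤ N.O.valuation (q 2 - q 3) ∧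
        N.O.valuation ((m : ℕ) * (q 2 - q 3)) ≤ N.O.valuation (z * (q 0 - q 1))) ?_
    refine hψ.not.imp ?_
    refine UDef.ex (P := fun N (w : Option (α ⊕ β) → N) z => ∀ q : Fin 4 → N,
        SameBall N.O m (fibreSet ψ (fun i => w (some (Sum.inl i))) (fun i => w (some (Sum.inr i))))
          (w none) (q 0) →
        SameBall N.O m (fibreSet ψ (fun i => w (some (Sum.inl i))) (fun i => w (some (Sum.inr i))))
          (w none) (q 1) →
        G N (fun i => w (some (Sum.inl i))) (fun i => w (some (Sum.inr i))) (q 0) (q 2) →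
        G N (fun i => w (some (Sum.inl i))) (fun i => w (some (Sum.inr i))) (q 1) (q 3) →
        N.O.valuation (z * (m : ℕ) * (q 0 - q 1)) ≤ N.O.valuation (q 2 - q 3) ∧
        N.O.valuation ((m : ℕ) * (q 2 - q 3)) ≤ N.O.valuation (z * (q 0 - q 1))) ?_
    refine UDef.alls (P := fun N (w : Option (Option (α ⊕ β)) → N) (q : Fin 4 → N) =>
        SameBall N.O m (fibreSet ψ (fun i => w (some (some (Sum.inl i))))
          (fun i => w (some (some (Sum.inr i))))) (w (some none)) (q 0) →
        SameBall N.O m (fibreSet ψ (fun i => w (some (some (Sum.inl i))))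
          (fun i => w (some (some (Sum.inr i))))) (w (some none)) (q 1) →
        G N (fun i => w (some (some (Sum.inl i)))) (fun i => w (some (some (Sum.inr i))))
          (q 0) (q 2) →
        G N (fun i => w (some (some (Sum.inl i)))) (fun i => w (some (some (Sum.inr i))))
          (q 1) (q 3) →
        N.O.valuation (w none * (m : ℕ) * (q 0 - q 1)) ≤ N.O.valuation (q 2 - q 3) ∧
        N.O.valuation ((m : ℕ) * (q 2 - q 3)) ≤ N.O.valuation (w none * (q 0 - q 1))) ?_
    have hS : ∀ i : Fin 4, UDef fun N (w : Option (Option (α ⊕ β)) ⊕ Fin 4 → N) =>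
        SameBall N.O m (fibreSet ψ (fun i => w (Sum.inl (some (some (Sum.inl i)))))
          (fun i => w (Sum.inl (some (some (Sum.inr i)))))) (w (Sum.inl (some none)))
          (w (Sum.inr i)) := fun i =>
      UDef.sameBall (P := fun N (w : Option (Option (α ⊕ β)) ⊕ Fin 4 → N) c => c ∈
        fibreSet ψ (fun i => w (Sum.inl (some (some (Sum.inl i)))))
          (fun i => w (Sum.inl (some (some (Sum.inr i))))))
        (hψ.reindex fun o => o.elim none fun i => some (Sum.inl (some (some i)))) m
        (UFun.var _) (UFun.var _)
    have hGq : ∀ i j : Fin 4, UDef fun N (w : Option (Option (α ⊕ β)) ⊕ Fin 4 → N) =>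
        G N (fun i => w (Sum.inl (some (some (Sum.inl i)))))
          (fun i => w (Sum.inl (some (some (Sum.inr i))))) (w (Sum.inr i)) (w (Sum.inr j)) :=
      fun i j => hG.reindex fun o => o.elim (Sum.inr j)
        fun o => o.elim (Sum.inr i) fun i => Sum.inl (some (some i))
    have hq : ∀ i j : Fin 4, UFun fun (N : VModel.{u, v, x} ι T)
        (w : Option (Option (α ⊕ β)) ⊕ Fin 4 → N) => w (Sum.inr i) - w (Sum.inr j) :=
      fun i j => (UFun.var _).sub (UFun.var _)
    exact (hS 0).imp ((hS 1).imp ((hGq 0 2).imp ((hGq 1 3).imp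
      (((((UFun.var _).mul (UFun.natCast m)).mul (hq 0 1)).val_le (hq 2 3)).and
        (((UFun.natCast m).mul (hq 2 3)).val_le ((UFun.var _).mul (hq 0 1)))))))

end Uniform

end Preparation

/-! ### Property (T1) in families -/

section Uniform

variable {L : FirstOrder.Language.{u, v}} {ι : langVal →ᴸ L} {T : L.Theory} {α β : Type} [Finite β]
  {G : ∀ N : VModel.{u, v, x} ι T, (α → N) → (β → N) → N → N → Prop}
  (hG : UDef fun N (w : Option (Option (α ⊕ β)) → N) =>
    G N (fun i => w (some (some (Sum.inl i)))) (fun i => w (some (some (Sum.inr i))))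
      (w (some none)) (w none))

omit [Finite β] in
theorem Witness.t1At {N : VModel.{u, v, x} ι T} {n : ℕ+} {G : (α → N) → (β → N) → N → N → Prop}
    {j : L.Formula (Option (α ⊕ β)) × ℕ+ × ℕ} {a : α → N} {b : β → N} (h : Witness n G j a b)
    {f : N → N} (hf : ∀ y z, G a b y z ↔ z = f y) :
    T1At N.O (fibreSet j.1 a b) j.2.1 f := by
  rw [t1At_iff]
  intro x₀ hx₀
  obtain ⟨z, hz⟩ := h.2.2 x₀ hx₀
  exact ⟨z, fun y y' hy hy' => hz ![y, y', f y, f y'] hy hy' ((hf _ _).2 rfl) ((hf _ _).2 rfl)⟩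

include hG in
/-- Each function of the family has a witness for (T1), which comes from a formula in the parameter
`a` and representatives `b`. -/
theorem exists_witness (hmin : IsOneHMinimal.{u, v, x} ι T) (n : ℕ+) (N : VModel.{u, v, x} ι T)
    (a : α → N) (b : β → N) (hgood : GoodFibre n (G N) a b) :
    ∃ j : L.Formula (Option (α ⊕ β)) × ℕ+ × ℕ, Witness n (G N) j a b := by
  obtain ⟨h1, h2, h3⟩ := hgood
  choose f hf using h1
  have hfG : ∀ y z, G N a b y z ↔ z = f y := fun y z =>
    ⟨fun h => h2 y _ _ h (hf y), fun h => h ▸ hf y⟩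
  have hd : DefinableOver L N.O (n := n) (Set.range a) (Set.range fun i => rv N.O n (b i))
      {y : Fin 2 → N | y 1 = f (y 0)} := by
    obtain ⟨k, ⟨e⟩⟩ := Finite.exists_equiv_fin β
    refine ⟨k, fun i => rv N.O n (b (e.symm i)), {y | G N a (fun i => y (Sum.inl (e i)))
      (y (Sum.inr 0)) (y (Sum.inr 1))}, fun i => ⟨_, rfl⟩, ?_, ?_⟩
    · exact definable_of_uDef (P := fun N (w : α ⊕ (Fin k ⊕ Fin 2) → N) =>
        G N (fun i => w (Sum.inl i)) (fun i => w (Sum.inr (Sum.inl (e i))))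
          (w (Sum.inr (Sum.inr 0))) (w (Sum.inr (Sum.inr 1))))
        (hG.reindex fun o => o.elim (Sum.inr (Sum.inr 1)) fun o => o.elim (Sum.inr (Sum.inr 0))
          (Sum.elim Sum.inl fun i => Sum.inr (Sum.inl (e i)))) N a
    · intro b' hb'
      ext y
      refine (hfG _ _).symm.trans (h3 _ (fun i => ?_) _ _)
      have : _ = rv N.O n (b (e.symm (e i))) := hb' (e i)
      rw [e.symm_apply_apply] at this
      exact this.symm
  obtain ⟨⟨C, m, hC, -, ⟨k, ξ, S, hξ, hS, hCS⟩, hT⟩, -⟩ := hmin N N.O N.valued N.models n _ _ f hd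
  choose σ hσ using hξ
  rw [Set.definable_iff_exists_formula_sum] at hS
  obtain ⟨φ, rfl⟩ := hS
  choose ρ hρ using fun c : Set.range a => c.2
  let ψ : L.Formula (Option (α ⊕ β)) := φ.relabel (Sum.elim (fun c => some (Sum.inl (ρ c)))
    (Sum.elim (fun i => some (Sum.inr (σ i))) fun _ => none))
  have hψ : ∀ b', RVEq N.O n b b' → ∀ y, y ∈ fibreSet ψ a b' ↔ y ∈ C := by
    intro b' hb' y
    have h4 := hCS (fun i => b' (σ i)) fun i => (hb' (σ i)).symm.trans (hσ i)
    have h5 : (fun _ : Fin 1 => y) ∈ {x : Fin 1 → N | x 0 ∈ C} ↔ y ∈ C := Iff.rfl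
    rw [← h5, h4]
    change Formula.Realize _ _ ↔ Formula.Realize _ _
    rw [Formula.realize_relabel]
    refine iff_of_eq (congrArg _ (funext fun o => ?_))
    rcases o with c | i | i
    · exact hρ c
    · rfl
    · rfl
  have hψC : fibreSet ψ a b = C := Set.ext (hψ b (RVEq.refl b))
  refine ⟨⟨ψ, m, C.ncard⟩, ?_, ?_, ?_⟩
  · change CardLE (fibreSet ψ a b) _
    rw [hψC]
    exact cardLE_iff.2 ⟨hC, le_rfl⟩
  · intro b' hb' y
    exact (hψ b (RVEq.refl b) y).trans (hψ b' hb' y).symm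
  · change ∀ x₀ ∉ fibreSet ψ a b, ∃ z : N, ∀ q : Fin 4 → N,
      SameBall N.O m (fibreSet ψ a b) x₀ (q 0) → SameBall N.O m (fibreSet ψ a b) x₀ (q 1) → _
    rw [hψC]
    intro x₀ hx₀
    obtain ⟨z, hz⟩ := t1At_iff.1 hT x₀ hx₀
    refine ⟨z, fun q h0 h1 hq0 hq1 => ?_⟩
    rw [hfG] at hq0 hq1
    rw [hq0, hq1]
    exact hz _ _ h0 h1

end Uniform

section UniformT1

variable {L : FirstOrder.Language.{u, v}} {ι : langVal →ᴸ L} {T : L.Theory} {α β : Type} [Finite β]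
  {G : ∀ N : VModel.{u, v, max u v x} ι T, (α → N) → (β → N) → N → N → Prop}
  (hG : UDef fun N (w : Option (Option (α ⊕ β)) → N) =>
    G N (fun i => w (some (some (Sum.inl i)))) (fun i => w (some (some (Sum.inr i))))
      (w (some none)) (w none))

include hG in
/-- Property (T1), uniformly in a family that is parametrized by a power of `RV_{|n|}`: one finite
set works for all members of the family. By compactness, finitely many formulas give finite sets
for the individual members, and the union of these sets over the family is finite. -/
theorem uniform_t1 (hmin : IsOneHMinimal.{u, v, max u v x} ι T) (n : ℕ+)
    (N : VModel.{u, v, max u v x} ι T) (hgood : ∀ a b, GoodFibre n (G N) a b) :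
    ∃ (Ψ : ∀ N : VModel.{u, v, max u v x} ι T, (α → N) → N → Prop) (m : ℕ+),
      (UDef fun N (w : Option α → N) => Ψ N (fun i => w (some i)) (w none)) ∧
      ∀ a : α → N, {y | Ψ N a y}.Finite ∧
        ∀ b f, (∀ y z, G N a b y z ↔ z = f y) → T1At N.O {y | Ψ N a y} m f := by
  classical
  obtain ⟨F, hF⟩ := UDef.compactness.{u, v, max u v, x}
    (P := fun j N (w : α ⊕ β → N) => GoodFibre n (G N) (fun i => w (Sum.inl i))
      (fun i => w (Sum.inr i)) → Witness n (G N) j (fun i => w (Sum.inl i)) (fun i => w (Sum.inr i)))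
    (fun j => (UDef.goodFibre hG n).imp (UDef.witness hG n j)) (fun N w => by
      by_cases h : GoodFibre n (G N) (fun i => w (Sum.inl i)) (fun i => w (Sum.inr i))
      · obtain ⟨j, hj⟩ := exists_witness hG hmin n N _ _ h
        exact ⟨j, fun _ => hj⟩
      · exact ⟨(⊥, 1, 0), fun h' => (h h').elim⟩) N
  let Ψ₀ : ∀ N : VModel.{u, v, max u v x} ι T, (α → N) → (β → N) → N → Prop := fun N a b y =>
    ∃ j : F, ∃ b₁, RVEq N.O n b b₁ ∧ Witness n (G N) j.1 a b₁ ∧ y ∈ fibreSet j.1.1 a b₁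
  have hΨ₀ : UDef fun N (w : Option (α ⊕ β) → N) => Ψ₀ N (fun i => w (some (Sum.inl i)))
      (fun i => w (some (Sum.inr i))) (w none) := by
    refine UDef.exists_finite (κ := F) fun j => ?_
    refine UDef.exs (P := fun N (w : Option (α ⊕ β) → N) b₁ =>
      RVEq N.O n (fun i => w (some (Sum.inr i))) b₁ ∧
        Witness n (G N) j.1 (fun i => w (some (Sum.inl i))) b₁ ∧
        w none ∈ fibreSet j.1.1 (fun i => w (some (Sum.inl i))) b₁) ?_
    refine (UDef.rvEq n _ _).and (((UDef.witness hG n j.1).reindex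
      (Sum.elim (fun i => Sum.inl (some (Sum.inl i))) Sum.inr)).and
      ((UDef.mem_fibreSet j.1.1).reindex fun o => o.elim (Sum.inl none)
        (Sum.elim (fun i => Sum.inl (some (Sum.inl i))) Sum.inr)))
  refine ⟨fun N a y => ∃ b, Ψ₀ N a b y, ∏ j ∈ F, j.2.1, ?_, fun a => ⟨?_, ?_⟩⟩
  · exact UDef.exs (P := fun N (w : Option α → N) b => Ψ₀ N (fun i => w (some i)) b (w none))
      (hΨ₀.reindex fun o => o.elim (Sum.inl none)
        (Sum.elim (fun i => Sum.inl (some i)) Sum.inr))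
  · refine finite_iUnion_rv_of_finite hmin β hΨ₀ N a n ?_ ?_
    · rintro b b' hb y ⟨j, b₁, h1, h2⟩
      exact ⟨j, b₁, hb.symm.trans h1, h2⟩
    · intro b
      have : {y | Ψ₀ N a b y} = ⋃ j : F, {y | ∃ b₁, RVEq N.O n b b₁ ∧ Witness n (G N) j.1 a b₁ ∧
          y ∈ fibreSet j.1.1 a b₁} := by
        ext y; simp [Ψ₀]
      rw [this]
      refine Set.finite_iUnion fun j => ?_
      by_cases h : ∃ b₁, RVEq N.O n b b₁ ∧ Witness n (G N) j.1 a b₁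
      · obtain ⟨b₁, h1, h2⟩ := h
        refine h2.1.finite.subset ?_
        rintro y ⟨b₂, h3, h4, h5⟩
        exact (h4.2.1 b₁ (h3.symm.trans h1) y).1 h5
      · convert Set.finite_empty
        ext y
        simp only [Set.mem_empty_iff_false, iff_false]
        rintro ⟨b₁, h1, h2, -⟩
        exact h ⟨b₁, h1, h2⟩
  · intro b f hf
    obtain ⟨j, hj, hW⟩ := hF (Sum.elim a b)
    have hW' : Witness n (G N) j a b := hW (hgood a b)
    refine (hW'.t1At hf).mono (fun y hy => ⟨b, ⟨j, hj⟩, b, RVEq.refl b, hW', hy⟩) ?_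
    exact Finset.dvd_prod_of_mem (fun j => j.2.1) hj

end UniformT1

/-! ### Coding finite sets by leading terms -/

section Averages

theorem finsum_mem_eq_of_enum {K : Type*} [Field K] {S : Set K} {j : ℕ} {c : Fin j → K}
    (hc : Function.Injective c) (hS : ∀ y, y ∈ S ↔ ∃ i, y = c i) :
    ∑ᶠ y ∈ S, y = ∑ i, c i := by
  have : S = Set.range c := by ext y; rw [hS]; simp [eq_comm]
  rw [this, finsum_mem_range hc, finsum_eq_sum_of_fintype]

variable {K : Type w} [Field K] [CharZero K] {O : ValuationSubring K}

theorem eq_zero_of_rv_eq_of_sum_eq_zero {s : ℕ} {t : Fin (s + 1) → K} {e : K}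
    (h : ∀ i, rv O s.succPNat (t i) = rv O s.succPNat e) (hsum : ∑ i, t i = 0) : e = 0 := by
  by_contra he
  have hne : O.valuation (((s.succPNat : ℕ+) : ℕ) * e) ≠ 0 := by
    simp [he]
    exact_mod_cast Nat.succ_ne_zero s
  have h1 : O.valuation (∑ i, (t i - e)) < O.valuation (((s.succPNat : ℕ+) : ℕ) * e) := by
    refine Valuation.map_sum_lt _ hne fun i _ => ?_
    rcases (rv_eq_rv_iff O _ _ _).1 (h i) with h' | h'
    · rw [h', sub_self, map_zero]
      exact zero_lt_iff.2 hne
    · exact h'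
  rw [Finset.sum_sub_distrib, hsum, zero_sub, Valuation.map_neg] at h1
  simp at h1

/-- The elements of a finite set with at least two elements do not all have the same leading term
relative to their average: they would be zero relative to it, as they sum up to zero. -/
theorem exists_rv_average_ne {s : ℕ} (hs : s ≠ 0) {q : Fin (s + 1) → K}
    (hq : Function.Injective q) (e : K) :
    ∃ i, rv O s.succPNat (((s + 1 : ℕ) : K) * q i - ∑ j, q j) ≠ rv O s.succPNat e := by
  by_contra! h
  have he : e = 0 := by
    refine eq_zero_of_rv_eq_of_sum_eq_zero h ?_
    rw [Finset.sum_sub_distrib, ← Finset.mul_sum]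
    simp
  have h0 : ∀ i, ((s + 1 : ℕ) : K) * q i = ∑ j, q j := fun i => by
    have := h i
    rw [he, (rv_eq_zero_iff O _ (0 : K)).2 rfl, rv_eq_zero_iff, sub_eq_zero] at this
    exact this
  have : q 0 = q (Fin.last s) :=
    mul_left_cancel₀ (a := ((s + 1 : ℕ) : K)) (by exact_mod_cast Nat.succ_ne_zero s)
      ((h0 _).trans (h0 _).symm)
  have := hq this
  exact hs (by simpa using (congrArg Fin.val this).symm)

end Averages

section Coding

variable {L : FirstOrder.Language.{u, v}} {ι : langVal →ᴸ L} {T : L.Theory} {δ : Type}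

/-- The elements of uniformly finite definable sets are definable from leading terms: each element
is determined by the leading terms, relative to the averages, in a decreasing chain of subsets. -/
theorem exists_coding (N : VModel.{u, v, x} ι T) (s : ℕ) :
    ∀ (β : Type) [Finite β] (n : ℕ+) (Ψ : ∀ N : VModel.{u, v, x} ι T, (δ → N) → (β → N) → N → Prop),
    (UDef fun N (w : Option (δ ⊕ β) → N) =>
      Ψ N (fun i => w (some (Sum.inl i))) (fun i => w (some (Sum.inr i))) (w none)) →
    (∀ a d d', RVEq N.O n d d' → ∀ c, Ψ N a d c → Ψ N a d' c) →
    (∀ a d, CardLE {c | Ψ N a d c} s) →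
    ∃ (β' : Type) (_ : Finite β') (n' : ℕ+)
      (Φ : ∀ N : VModel.{u, v, x} ι T, (δ → N) → (β ⊕ β' → N) → N → Prop),
      (UDef fun N (w : Option (δ ⊕ (β ⊕ β')) → N) =>
        Φ N (fun i => w (some (Sum.inl i))) (fun i => w (some (Sum.inr i))) (w none)) ∧
      (∀ a d d', RVEq N.O n' d d' → ∀ c, Φ N a d c → Φ N a d' c) ∧
      (∀ a d c c', Φ N a d c → Φ N a d c' → c = c') ∧
      ∀ a d c, Ψ N a d c ↔ ∃ e, Φ N a (Sum.elim d e) c := by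
  have base : ∀ (β : Type) [Finite β] (n : ℕ+)
      (Ψ : ∀ N : VModel.{u, v, x} ι T, (δ → N) → (β → N) → N → Prop),
      (UDef fun N (w : Option (δ ⊕ β) → N) =>
        Ψ N (fun i => w (some (Sum.inl i))) (fun i => w (some (Sum.inr i))) (w none)) →
      (∀ a d d', RVEq N.O n d d' → ∀ c, Ψ N a d c → Ψ N a d' c) →
      (∀ a d c c', Ψ N a d c → Ψ N a d c' → c = c') →
      ∃ (β' : Type) (_ : Finite β') (n' : ℕ+)
        (Φ : ∀ N : VModel.{u, v, x} ι T, (δ → N) → (β ⊕ β' → N) → N → Prop),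
        (UDef fun N (w : Option (δ ⊕ (β ⊕ β')) → N) =>
          Φ N (fun i => w (some (Sum.inl i))) (fun i => w (some (Sum.inr i))) (w none)) ∧
        (∀ a d d', RVEq N.O n' d d' → ∀ c, Φ N a d c → Φ N a d' c) ∧
        (∀ a d c c', Φ N a d c → Φ N a d c' → c = c') ∧
        ∀ a d c, Ψ N a d c ↔ ∃ e, Φ N a (Sum.elim d e) c := by
    intro β _ n Ψ hΨ hinv hsub
    refine ⟨Empty, inferInstance, n, fun N a d c => Ψ N a (fun i => d (Sum.inl i)) c, ?_, ?_, ?_, ?_⟩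
    · exact hΨ.reindex fun o => o.elim none
        (Sum.elim (fun i => some (Sum.inl i)) fun i => some (Sum.inr (Sum.inl i)))
    · exact fun a d d' h => hinv _ _ _ fun i => h _
    · exact fun a d => hsub a _
    · exact fun a d c => ⟨fun h => ⟨Empty.elim, h⟩, fun ⟨_, h⟩ => h⟩
  induction s with
  | zero =>
    intro β _ n Ψ hΨ hinv hcard
    refine base β n Ψ hΨ hinv fun a d c _ h => ?_
    obtain ⟨q, hq⟩ := hcard a d
    exact (hq c h).choose.elim0
  | succ s ih =>
    intro β _ n Ψ hΨ hinv hcard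
    by_cases hs : s = 0
    · subst hs
      refine base β n Ψ hΨ hinv fun a d c c' h h' => ?_
      obtain ⟨q, hq⟩ := hcard a d
      obtain ⟨i, rfl⟩ := hq c h
      obtain ⟨j, rfl⟩ := hq c' h'
      rw [show i = j from Fin.ext (by omega)]
    let Ψ' : ∀ N : VModel.{u, v, x} ι T, (δ → N) → (β ⊕ Unit → N) → N → Prop := fun N a d c =>
      Ψ N a (fun i => d (Sum.inl i)) c ∧ ∀ q : Fin (s + 1) → N,
        ((∀ i j, q i = q j → i = j) ∧ ∀ y, Ψ N a (fun i => d (Sum.inl i)) y ↔ ∃ i, y = q i) →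
        rv N.O s.succPNat (((s + 1 : ℕ) : N) * c - ∑ j, q j) = rv N.O s.succPNat (d (Sum.inr ()))
    have hset : ∀ a d d', RVEq N.O n d d' → ∀ c, Ψ N a d c ↔ Ψ N a d' c := fun a d d' h c =>
      ⟨hinv a d d' h c, hinv a d' d h.symm c⟩
    obtain ⟨β', hβ', n', Φ, hΦ, h1, h2, h3⟩ := ih (β ⊕ Unit) (n * s.succPNat) Ψ' (by
      refine UDef.and (hΨ.reindex fun o => o.elim none
        (Sum.elim (fun i => some (Sum.inl i)) fun i => some (Sum.inr (Sum.inl i)))) ?_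
      refine UDef.alls (P := fun N (w : Option (δ ⊕ (β ⊕ Unit)) → N) (q : Fin (s + 1) → N) =>
        ((∀ i j, q i = q j → i = j) ∧ ∀ y, Ψ N (fun i => w (some (Sum.inl i)))
          (fun i => w (some (Sum.inr (Sum.inl i)))) y ↔ ∃ i, y = q i) →
        rv N.O s.succPNat (((s + 1 : ℕ) : N) * w none - ∑ j, q j) =
          rv N.O s.succPNat (w (some (Sum.inr (Sum.inr ()))))) ?_
      refine UDef.imp (UDef.and ?_ ?_) ?_
      · exact UDef.forall_finite fun i => UDef.forall_finite fun j =>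
          ((UFun.var _).eq (UFun.var _)).imp (UDef.const _)
      · refine UDef.all (P := fun N (w : Option (δ ⊕ (β ⊕ Unit)) ⊕ Fin (s + 1) → N) y =>
          Ψ N (fun i => w (Sum.inl (some (Sum.inl i))))
            (fun i => w (Sum.inl (some (Sum.inr (Sum.inl i))))) y ↔ ∃ i, y = w (Sum.inr i)) ?_
        exact (hΨ.reindex fun o => o.elim none
          (Sum.elim (fun i => some (Sum.inl (some (Sum.inl i))))
            fun i => some (Sum.inl (some (Sum.inr (Sum.inl i)))))).iff
          (UDef.exists_finite fun i => (UFun.var _).eq (UFun.var _))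
      · exact UFun.rv_eq _ (((UFun.natCast _).mul (UFun.var _)).sub
          (UFun.sum fun i => UFun.var _)) (UFun.var _))
      (by
        rintro a d d' hd c ⟨hc, hq⟩
        have hd1 : RVEq N.O n (fun i => d (Sum.inl i)) (fun i => d' (Sum.inl i)) :=
          fun i => (hd.of_dvd (Dvd.intro _ rfl)) _
        refine ⟨hinv _ _ _ hd1 _ hc, fun q hq' => ?_⟩
        rw [hq q ⟨hq'.1, fun y => (hset a _ _ hd1 y).trans (hq'.2 y)⟩]
        exact (hd.of_dvd (Dvd.intro_left _ rfl)) _)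
      (by
        intro a d
        obtain ⟨hf, hle⟩ := cardLE_iff.1 (hcard a fun i => d (Sum.inl i))
        have hsub : {c | Ψ' N a d c} ⊆ {c | Ψ N a (fun i => d (Sum.inl i)) c} := fun c hc => hc.1
        refine cardLE_iff.2 ⟨hf.subset hsub, ?_⟩
        rcases hle.lt_or_eq with hlt | heq
        · exact (Set.ncard_le_ncard hsub hf).trans (Nat.le_of_lt_succ hlt)
        · obtain ⟨q, hq, hqe⟩ := (ncard_eq_iff_exists_enum hf).1 heq
          obtain ⟨i, hi⟩ := exists_rv_average_ne (O := N.O) hs hq (d (Sum.inr ()))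
          have : {c | Ψ' N a d c} ⊂ {c | Ψ N a (fun i => d (Sum.inl i)) c} :=
            ⟨hsub, fun h => hi ((h ((hqe _).2 ⟨i, rfl⟩)).2 q ⟨fun i j h => hq h, hqe⟩)⟩
          exact Nat.le_of_lt_succ ((Set.ncard_lt_ncard this hf).trans_eq heq))
    refine ⟨Unit ⊕ β', inferInstance, n',
      fun N a d c => Φ N a (fun i => d (Equiv.sumAssoc β Unit β' i)) c, ?_, ?_, ?_, ?_⟩
    · exact hΦ.reindex fun o => o.elim none
        (Sum.elim (fun i => some (Sum.inl i))
          fun i => some (Sum.inr (Equiv.sumAssoc β Unit β' i)))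
    · exact fun a d d' h => h1 _ _ _ fun i => h _
    · exact fun a d => h2 a _
    · intro a d c
      have hcomb : ∀ (t : N) (e : β' → N), (fun i => Sum.elim d (Sum.elim (fun _ : Unit => t) e)
          (Equiv.sumAssoc β Unit β' i)) = Sum.elim (Sum.elim d fun _ => t) e := by
        intro t e
        funext i
        rcases i with (i | i) | i <;> rfl
      constructor
      · intro hc
        have hΨ' : Ψ' N a (Sum.elim d fun _ =>
            ((s + 1 : ℕ) : N) * c - ∑ᶠ y ∈ {y | Ψ N a d y}, y) c := by
          refine ⟨hc, fun q hq => ?_⟩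
          rw [← finsum_mem_eq_of_enum (S := {y | Ψ N a d y}) (fun i j => hq.1 i j) hq.2]
          rfl
        obtain ⟨t, ht⟩ : ∃ t, Ψ' N a (Sum.elim d fun _ => t) c := ⟨_, hΨ'⟩
        obtain ⟨e, he⟩ := (h3 _ _ _).1 ht
        refine ⟨Sum.elim (fun _ => t) e, ?_⟩
        change Φ N a (fun i => Sum.elim d _ (Equiv.sumAssoc β Unit β' i)) c
        rw [hcomb]
        exact he
      · rintro ⟨e, he⟩
        have : e = Sum.elim (fun _ : Unit => e (Sum.inl ())) fun i => e (Sum.inr i) := by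
          funext i; rcases i with i | i <;> rfl
        change Φ N a (fun i => Sum.elim d e (Equiv.sumAssoc β Unit β' i)) c at he
        rw [this, hcomb] at he
        exact ((h3 _ _ _).2 ⟨_, he⟩).1

end Coding

/-! ### Stable embeddedness of the leading terms -/

section StableEmbedding

variable {L : FirstOrder.Language.{u, v}} {ι : langVal →ᴸ L} {T : L.Theory}

/-- Uniform preparation: for a definable family of sets that is parametrized by a power of
`RV_{|n|}`, there is one finite set, definable over the remaining parameters, such that all balls
`|m|`-next to it are contained in or disjoint from each member of the family. -/
theorem uniform_preparation (hmin : IsOneHMinimal.{u, v, max u v x} ι T)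
    {α β : Type} [Finite β] (n : ℕ+)
    {R : ∀ N : VModel.{u, v, max u v x} ι T, (α → N) → (β → N) → N → Prop}
    (hR : UDef fun N (w : Option (α ⊕ β) → N) =>
      R N (fun i => w (some (Sum.inl i))) (fun i => w (some (Sum.inr i))) (w none))
    (N : VModel.{u, v, max u v x} ι T)
    (hinv : ∀ a b b', RVEq N.O n b b' → ∀ y, R N a b y → R N a b' y) :
    ∃ (Ψ : ∀ N : VModel.{u, v, max u v x} ι T, (α → N) → N → Prop) (m : ℕ+),
      (UDef fun N (w : Option α → N) => Ψ N (fun i => w (some i)) (w none)) ∧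
      ∀ a : α → N, {y | Ψ N a y}.Finite ∧ ∀ b y y', ¬ Ψ N a y →
        SameBall N.O m {c | Ψ N a c} y y' → (R N a b y' ↔ R N a b y) := by
  obtain ⟨Ψ, m, hΨ, h⟩ := uniform_t1 (G := fun N a b y z => (R N a b y ∧ z = 1) ∨
    (¬ R N a b y ∧ z = 0)) (by
      have := hR.reindex fun o => o.elim (some none) fun i => some (some i)
      exact (this.and ((UFun.var _).eq UFun.one)).or (this.not.and ((UFun.var _).eq UFun.zero)))
    hmin n N (by
      intro a b
      refine ⟨fun y => ?_, fun y z z' h h' => ?_, fun b' hb y z => ?_⟩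
      · by_cases hy : R N a b y
        · exact ⟨1, Or.inl ⟨hy, rfl⟩⟩
        · exact ⟨0, Or.inr ⟨hy, rfl⟩⟩
      · rcases h with ⟨h, rfl⟩ | ⟨h, rfl⟩ <;> rcases h' with ⟨h', rfl⟩ | ⟨h', rfl⟩ <;>
          first | rfl | exact absurd h h' | exact absurd h' h
      · have : R N a b y ↔ R N a b' y := ⟨hinv _ _ _ hb _, hinv _ _ _ hb.symm _⟩
        exact or_congr (and_congr_left' this) (and_congr_left' (not_congr this)))
  refine ⟨Ψ, m, hΨ, fun a => ⟨(h a).1, fun b y y' hy hyy' => ?_⟩⟩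
  refine ((h a).2 b (charFun {y | R N a b y}) fun y z => ?_).mem_iff N.valued.nontrivial (h a).1
    hy hyy'
  by_cases hy : R N a b y <;> simp [charFun, hy]

/-- The sorts `RV_{|n|}` are stably embedded: the fibres of a definable relation between tuples in
the field and tuples in `RV_{|n|}` form a family that is parametrized by tuples in `RV_{|n'|}`. -/
theorem rv_stablyEmbedded (hmin : IsOneHMinimal.{u, v, max u v x} ι T)
    (N : VModel.{u, v, max u v x} ι T) (δ : Type) [Finite δ] :
    ∀ (β : Type) [Finite β] (n : ℕ+)
      (R : ∀ N : VModel.{u, v, max u v x} ι T, (δ → N) → (β → N) → Prop),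
      (UDef fun N (w : δ ⊕ β → N) => R N (fun i => w (Sum.inl i)) (fun i => w (Sum.inr i))) →
      (∀ a b b', RVEq N.O n b b' → R N a b → R N a b') →
      ∃ (ε : Type) (_ : Finite ε) (n' : ℕ+)
        (S : ∀ N : VModel.{u, v, max u v x} ι T, (ε → N) → (β → N) → Prop),
        (UDef fun N (w : ε ⊕ β → N) => S N (fun i => w (Sum.inl i)) (fun i => w (Sum.inr i))) ∧
        (∀ e e' b b', RVEq N.O n' e e' → RVEq N.O n' b b' → S N e b → S N e' b') ∧
        ∀ a, ∃ e, ∀ b, R N a b ↔ S N e b := by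
  refine Finite.induction_empty_option (P := fun δ => ∀ (β : Type) [Finite β] (n : ℕ+)
      (R : ∀ N : VModel.{u, v, max u v x} ι T, (δ → N) → (β → N) → Prop),
      (UDef fun N (w : δ ⊕ β → N) => R N (fun i => w (Sum.inl i)) (fun i => w (Sum.inr i))) →
      (∀ a b b', RVEq N.O n b b' → R N a b → R N a b') →
      ∃ (ε : Type) (_ : Finite ε) (n' : ℕ+)
        (S : ∀ N : VModel.{u, v, max u v x} ι T, (ε → N) → (β → N) → Prop),
        (UDef fun N (w : ε ⊕ β → N) => S N (fun i => w (Sum.inl i)) (fun i => w (Sum.inr i))) ∧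
        (∀ e e' b b', RVEq N.O n' e e' → RVEq N.O n' b b' → S N e b → S N e' b') ∧
        ∀ a, ∃ e, ∀ b, R N a b ↔ S N e b) ?_ ?_ ?_ δ
  · intro δ δ' f ih β _ n R hR hinv
    obtain ⟨ε, hε, n', S, hS, h1, h2⟩ := ih β n (fun N a b => R N (fun i => a (f.symm i)) b)
      (hR.reindex (Sum.elim (fun i => Sum.inl (f.symm i)) Sum.inr)) fun a => hinv _
    refine ⟨ε, hε, n', S, hS, h1, fun a => ?_⟩
    obtain ⟨e, he⟩ := h2 fun i => a (f i)
    exact ⟨e, fun b => by simpa using he b⟩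
  · intro β _ n R hR hinv
    refine ⟨PEmpty, inferInstance, n, R, hR, fun e e' b b' _ hb => ?_, fun a => ⟨a, fun b => Iff.rfl⟩⟩
    rw [Subsingleton.elim e e']
    exact hinv _ _ _ hb
  · intro δ _ ih β _ n R hR hinv
    obtain ⟨Ψ, m, hΨ, hprep⟩ := uniform_preparation hmin (α := δ) (β := β) n
      (R := fun N a b y => R N (fun o => o.elim y a) b) (by
        refine (hR.reindex (Sum.elim (fun o => o.elim none fun i => some (Sum.inl i))
          fun i => some (Sum.inr i))).congr fun N w => ?_
        refine iff_of_eq (congrArg (fun f => R N f _) (funext fun o => ?_))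
        rcases o with _ | i <;> rfl) N fun a b b' hb y => hinv _ _ _ hb
    -- Adding `0` makes the preparing sets non-empty, so that they can be enumerated.
    let Ψ' : ∀ N : VModel.{u, v, max u v x} ι T, (δ → N) → N → Prop := fun N a y => Ψ N a y ∨ y = 0
    have hΨ' : UDef fun N (w : Option δ → N) => Ψ' N (fun i => w (some i)) (w none) :=
      hΨ.or ((UFun.var _).eq UFun.zero)
    have hfin : ∀ a, {y | Ψ' N a y}.Finite := fun a =>
      ((hprep a).1.union (Set.finite_singleton 0)).subset fun y hy => hy
    obtain ⟨s, hs⟩ := uniform_finiteness hmin hΨ' N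
    obtain ⟨β', hβ', n₁, Φ, hΦ, hΦinv, hΦsub, hΦcode⟩ := exists_coding N s Empty 1
      (fun N a _ y => Ψ' N a y)
      (hΨ'.reindex fun o => o.elim none fun i => some (Sum.inl i))
      (fun _ _ _ _ _ h => h) fun a _ => hs a (hfin a)
    let Φ' : ∀ N : VModel.{u, v, max u v x} ι T, (δ → N) → (β' → N) → N → Prop :=
      fun N a e y => Φ N a (Sum.elim Empty.elim e) y
    have hΦ' : UDef fun N (w : Option (δ ⊕ β') → N) =>
        Φ' N (fun i => w (some (Sum.inl i))) (fun i => w (some (Sum.inr i))) (w none) := by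
      refine (hΦ.reindex fun o => o.elim none (Sum.elim (fun i => some (Sum.inl i))
        (Sum.elim Empty.elim fun i => some (Sum.inr i)))).congr fun N w => ?_
      refine iff_of_eq (congrArg (fun f => Φ N _ f _) (funext fun o => ?_))
      rcases o with o | i
      · exact o.elim
      · rfl
    have hΦ'inv : ∀ a e e', RVEq N.O n₁ e e' → ∀ y, Φ' N a e y → Φ' N a e' y := by
      intro a e e' he
      refine hΦinv a _ _ fun o => ?_
      rcases o with o | i
      · exact o.elim
      · exact he i
    let Q : Type := (Fin s × β') ⊕ (Fin s ⊕ β)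
    let T' : ∀ N : VModel.{u, v, max u v x} ι T, (δ → N) → (Q → N) → Prop := fun N a q =>
      ∃ y, (∀ i, ∃ c, Φ' N a (fun j => q (Sum.inl (i, j))) c ∧
        rv N.O m (y - c) = rv N.O m (q (Sum.inr (Sum.inl i)))) ∧
        R N (fun o => o.elim y a) fun i => q (Sum.inr (Sum.inr i))
    have hT' : UDef fun N (w : δ ⊕ Q → N) =>
        T' N (fun i => w (Sum.inl i)) (fun i => w (Sum.inr i)) := by
      refine UDef.ex (P := fun N (w : δ ⊕ Q → N) y =>
        (∀ i, ∃ c, Φ' N (fun i => w (Sum.inl i)) (fun j => w (Sum.inr (Sum.inl (i, j)))) c ∧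
        rv N.O m (y - c) = rv N.O m (w (Sum.inr (Sum.inr (Sum.inl i))))) ∧
        R N (fun o => o.elim y fun i => w (Sum.inl i))
          fun i => w (Sum.inr (Sum.inr (Sum.inr i)))) ?_
      refine UDef.and (UDef.forall_finite fun i => ?_) ?_
      · refine UDef.ex (P := fun N (w : Option (δ ⊕ Q) → N) c =>
          Φ' N (fun i => w (some (Sum.inl i))) (fun j => w (some (Sum.inr (Sum.inl (i, j))))) c ∧
          rv N.O m (w none - c) = rv N.O m (w (some (Sum.inr (Sum.inr (Sum.inl i)))))) ?_
        exact (hΦ'.reindex fun o => o.elim none (Sum.elim (fun i => some (some (Sum.inl i)))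
          fun j => some (some (Sum.inr (Sum.inl (i, j)))))).and
          (UFun.rv_eq m ((UFun.var _).sub (UFun.var _)) (UFun.var _))
      · refine (hR.reindex (Sum.elim (fun o => o.elim none fun i => some (Sum.inl i))
          fun i => some (Sum.inr (Sum.inr (Sum.inr i))))).congr fun N w => ?_
        refine iff_of_eq (congrArg (fun f => R N f _) (funext fun o => ?_))
        rcases o with _ | i <;> rfl
    obtain ⟨ε, hε, n', S, hS, hSinv, hScode⟩ := ih Q (n₁ * m * n) T' hT' (by
      rintro a q q' hq ⟨y, h1, h2⟩
      refine ⟨y, fun i => ?_, hinv _ _ _ (fun i => ?_) h2⟩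
      · obtain ⟨c, hc, hyc⟩ := h1 i
        refine ⟨c, hΦ'inv _ _ _ (fun j => ?_) c hc, hyc.trans ?_⟩
        · exact (hq.of_dvd (by rw [mul_assoc]; exact Dvd.intro _ rfl)) _
        · exact (hq.of_dvd ((Dvd.intro_left _ rfl).trans (Dvd.intro _ rfl))) _
      · exact (hq.of_dvd (Dvd.intro_left _ rfl)) _)
    refine ⟨ε ⊕ ((Fin s × β') ⊕ Fin s), inferInstance, n', fun N e b =>
      S N (fun i => e (Sum.inl i)) (Sum.elim (fun i => e (Sum.inr (Sum.inl i)))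
        (Sum.elim (fun i => e (Sum.inr (Sum.inr i))) b)), ?_, ?_, ?_⟩
    · refine (hS.reindex (Sum.elim (fun i => Sum.inl (Sum.inl i))
        (Sum.elim (fun i => Sum.inl (Sum.inr (Sum.inl i)))
          (Sum.elim (fun i => Sum.inl (Sum.inr (Sum.inr i))) Sum.inr)))).congr fun N w => ?_
      refine iff_of_eq (congrArg (fun f => S N _ f) (funext fun o => ?_))
      rcases o with i | i | i <;> rfl
    · intro e e' b b' he hb
      refine hSinv _ _ _ _ (fun i => he _) fun o => ?_
      rcases o with i | i | i
      · exact he _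
      · exact he _
      · exact hb _
    · intro a
      set y : N := a none with hy
      set a' : δ → N := fun i => a (some i) with ha'
      have ha : a = fun o => o.elim y a' := by
        funext o; rcases o with _ | i <;> rfl
      obtain ⟨c, hcΨ, hcsurj⟩ : ∃ c : Fin s → N, (∀ i, Ψ' N a' (c i)) ∧
          ∀ z, Ψ' N a' z → ∃ i, z = c i := by
        classical
        obtain ⟨c, hc⟩ := hs a' (hfin a')
        refine ⟨fun i => if Ψ' N a' (c i) then c i else 0, fun i => ?_, fun z hz => ?_⟩
        · dsimp only
          split_ifs with h
          · exact h
          · exact Or.inr rfl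
        · obtain ⟨i, rfl⟩ := hc z hz
          exact ⟨i, (if_pos hz).symm⟩
      have hcode : ∀ i, ∃ e : β' → N, Φ' N a' e (c i) := by
        intro i
        obtain ⟨e, he⟩ := (hΦcode a' Empty.elim (c i)).1 (hcΨ i)
        exact ⟨e, he⟩
      choose e he using hcode
      obtain ⟨θ, hθ⟩ := hScode a'
      refine ⟨Sum.elim θ (Sum.elim (fun p => e p.1 p.2) fun i => y - c i), fun b => ?_⟩
      refine Iff.trans ?_ (hθ (Sum.elim (fun p => e p.1 p.2) (Sum.elim (fun i => y - c i) b)))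
      rw [ha]
      constructor
      · intro hRb
        exact ⟨y, fun i => ⟨c i, he i, rfl⟩, hRb⟩
      · rintro ⟨y', h1, h2⟩
        change R N (fun o => o.elim y' a') b at h2
        have hball : SameBall N.O m {z | Ψ' N a' z} y y' := by
          intro z hz
          obtain ⟨i, rfl⟩ := hcsurj z hz
          obtain ⟨c', hc', hrv⟩ := h1 i
          have : c' = c i := hΦsub _ _ _ _ hc' (he i)
          rw [this] at hrv
          exact hrv
        by_cases hyΨ : Ψ' N a' y
        · have := hball y hyΨ
          rw [sub_self, (rv_eq_zero_iff N.O m (0 : N)).2 rfl, rv_eq_zero_iff, sub_eq_zero] at this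
          rw [this] at h2
          exact h2
        · exact ((hprep a').2 b y y' (fun h => hyΨ (Or.inl h))
            (hball.mono (fun z hz => Or.inl hz) dvd_rfl)).1 h2

end StableEmbedding

/-! ### Definable sets in expansions by predicates on leading terms -/

section RVDef

variable {L : FirstOrder.Language.{u, v}} {ι : langVal →ᴸ L} {T : L.Theory}

/-- The predicate `X` on tuples in `N` is of the form `∃ b, R a b ∧ Z b`, where `R` is definable
without parameters and `Z` is an arbitrary predicate on leading terms. -/
def RVDef (N : VModel.{u, v, x} ι T) {γ : Type} (X : (γ → N) → Prop) : Prop :=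
  ∃ (β : Type) (_ : Finite β) (n : ℕ+)
    (R : ∀ N : VModel.{u, v, x} ι T, (γ → N) → (β → N) → Prop) (Z : (β → N) → Prop),
    (UDef fun N (w : γ ⊕ β → N) => R N (fun i => w (Sum.inl i)) (fun i => w (Sum.inr i))) ∧
    (∀ b b', RVEq N.O n b b' → Z b → Z b') ∧ ∀ a, X a ↔ ∃ b, R N a b ∧ Z b

namespace RVDef

variable {γ γ' : Type}

section General

variable {N : VModel.{u, v, x} ι T} {X Y : (γ → N) → Prop}

theorem congr (hX : RVDef N X) (h : ∀ a, X a ↔ Y a) : RVDef N Y := by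
  obtain ⟨β, hβ, n, R, Z, hR, hZ, hX⟩ := hX
  exact ⟨β, hβ, n, R, Z, hR, hZ, fun a => (h a).symm.trans (hX a)⟩

theorem of_uDef {P : ∀ N : VModel.{u, v, x} ι T, (γ → N) → Prop} (hP : UDef P)
    (N : VModel.{u, v, x} ι T) : RVDef N (P N) :=
  ⟨Empty, inferInstance, 1, fun N a _ => P N a, fun _ => True, hP.reindex Sum.inl,
    fun _ _ _ h => h, fun _ => ⟨fun h => ⟨Empty.elim, h, trivial⟩, fun ⟨_, h, _⟩ => h⟩⟩

/-- Predicates on leading terms are of the required form. -/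
theorem of_rv {β : Type} [Finite β] {t : β → ∀ N : VModel.{u, v, x} ι T, (γ → N) → N}
    (ht : ∀ i, UFun (t i)) (n : ℕ+) {Z : (β → N) → Prop}
    (hZ : ∀ b b', RVEq N.O n b b' → Z b → Z b') : RVDef N fun a => Z fun i => t i N a := by
  refine ⟨β, inferInstance, n, fun N a b => ∀ i, b i = t i N a, Z, ?_, hZ, fun a => ?_⟩
  · exact UDef.forall_finite fun i => (UFun.var _).eq ((ht i).reindex Sum.inl)
  · constructor
    · exact fun h => ⟨_, fun _ => rfl, h⟩
    · rintro ⟨b, hb, h⟩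
      rwa [← funext hb]

theorem reindex (hX : RVDef N X) (f : γ → γ') : RVDef N fun a => X fun i => a (f i) := by
  obtain ⟨β, hβ, n, R, Z, hR, hZ, hX⟩ := hX
  exact ⟨β, hβ, n, fun N a b => R N (fun i => a (f i)) b, Z,
    hR.reindex (Sum.elim (fun i => Sum.inl (f i)) Sum.inr), hZ, fun a => hX _⟩

theorem and (hX : RVDef N X) (hY : RVDef N Y) : RVDef N fun a => X a ∧ Y a := by
  obtain ⟨β, hβ, n, R, Z, hR, hZ, hX⟩ := hX
  obtain ⟨β', hβ', n', R', Z', hR', hZ', hY⟩ := hY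
  refine ⟨β ⊕ β', inferInstance, n * n', fun N a b => R N a (fun i => b (Sum.inl i)) ∧
    R' N a (fun i => b (Sum.inr i)), fun b => Z (fun i => b (Sum.inl i)) ∧
    Z' (fun i => b (Sum.inr i)), ?_, ?_, fun a => ?_⟩
  · exact (hR.reindex (Sum.elim Sum.inl fun i => Sum.inr (Sum.inl i))).and
      (hR'.reindex (Sum.elim Sum.inl fun i => Sum.inr (Sum.inr i)))
  · rintro b b' hb ⟨h, h'⟩
    exact ⟨hZ _ _ (fun i => (hb.of_dvd (Dvd.intro _ rfl)) _) h,
      hZ' _ _ (fun i => (hb.of_dvd (Dvd.intro_left _ rfl)) _) h'⟩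
  · refine (and_congr (hX a) (hY a)).trans ?_
    constructor
    · rintro ⟨⟨b, h1, h2⟩, b', h3, h4⟩
      exact ⟨Sum.elim b b', ⟨h1, h3⟩, h2, h4⟩
    · rintro ⟨b, ⟨h1, h3⟩, h2, h4⟩
      exact ⟨⟨_, h1, h2⟩, _, h3, h4⟩

theorem ex {X : (Option γ → N) → Prop} (hX : RVDef N X) :
    RVDef N fun a : γ → N => ∃ y, X fun o => o.elim y a := by
  obtain ⟨β, hβ, n, R, Z, hR, hZ, hX⟩ := hX
  refine ⟨β, hβ, n, fun N a b => ∃ y, R N (fun o => o.elim y a) b, Z, ?_, hZ, fun a => ?_⟩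
  · refine UDef.ex (P := fun N (w : γ ⊕ β → N) y =>
      R N (fun o => o.elim y fun i => w (Sum.inl i)) fun i => w (Sum.inr i)) ?_
    refine (hR.reindex (Sum.elim (fun o => o.elim none fun i => some (Sum.inl i))
      fun i => some (Sum.inr i))).congr fun N w => ?_
    refine iff_of_eq (congrArg (fun f => R N f _) (funext fun o => ?_))
    rcases o with _ | i <;> rfl
  · simp only [hX]
    exact ⟨fun ⟨y, b, h1, h2⟩ => ⟨b, ⟨y, h1⟩, h2⟩, fun ⟨b, ⟨y, h1⟩, h2⟩ => ⟨y, b, h1, h2⟩⟩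

end General

/-- Closure under complements: by stable embeddedness, `a` enters the condition on leading terms
only through a tuple of leading terms. -/
theorem not (hmin : IsOneHMinimal.{u, v, max u v x} ι T) {N : VModel.{u, v, max u v x} ι T}
    [Finite γ] {X : (γ → N) → Prop} (hX : RVDef N X) : RVDef N fun a => ¬ X a := by
  obtain ⟨β, hβ, n, R, Z, hR, hZ, hX⟩ := hX
  have hR' : UDef fun (N : VModel.{u, v, max u v x} ι T) (w : γ ⊕ β → N) =>
      ∃ b', RVEq N.O n (fun i => w (Sum.inr i)) b' ∧ R N (fun i => w (Sum.inl i)) b' :=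
    UDef.exs (P := fun N (w : γ ⊕ β → N) b' => RVEq N.O n (fun i => w (Sum.inr i)) b' ∧
      R N (fun i => w (Sum.inl i)) b')
      ((UDef.rvEq n _ _).and (hR.reindex (Sum.elim (fun i => Sum.inl (Sum.inl i)) Sum.inr)))
  obtain ⟨ε, hε, n', S, hS, hSinv, hcode⟩ := rv_stablyEmbedded hmin N γ β n
    (fun N a b => ∃ b', RVEq N.O n b b' ∧ R N a b') hR'
    (fun a b b' hb ⟨b₁, h1, h2⟩ => ⟨b₁, hb.symm.trans h1, h2⟩)
  refine ⟨ε, hε, n', fun N a e => ∀ b, (∃ b', RVEq N.O n b b' ∧ R N a b') ↔ S N e b,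
    fun e => ∀ b, S N e b → ¬ Z b, ?_, ?_, fun a => ?_⟩
  · refine UDef.alls (P := fun N (w : γ ⊕ ε → N) b =>
      (∃ b', RVEq N.O n b b' ∧ R N (fun i => w (Sum.inl i)) b') ↔
        S N (fun i => w (Sum.inr i)) b) ?_
    exact (hR'.reindex (Sum.elim (fun i => Sum.inl (Sum.inl i)) Sum.inr)).iff
      (hS.reindex (Sum.elim (fun i => Sum.inl (Sum.inr i)) Sum.inr))
  · exact fun e e' he h b hb => h b (hSinv _ _ _ _ he.symm (RVEq.refl b) hb)
  · refine (not_congr (hX a)).trans ?_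
    constructor
    · intro h
      obtain ⟨e, he⟩ := hcode a
      refine ⟨e, he, fun b hb hZb => h ?_⟩
      obtain ⟨b', h1, h2⟩ := (he b).2 hb
      exact ⟨b', h2, hZ _ _ h1 hZb⟩
    · rintro ⟨e, he, h⟩ ⟨b, h1, h2⟩
      exact h b ((he b).1 ⟨b, RVEq.refl b, h1⟩) h2

end RVDef

end RVDef

section Expansion

variable {L : FirstOrder.Language.{u, v}} {ι : langVal →ᴸ L} {T : L.Theory} {R : ℕ → Type r}

theorem exists_term_of_sum {M : Type*} [L.Structure M] [(L.sum (relLanguage R)).Structure M]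
    [(LHom.sumInl : L →ᴸ L.sum (relLanguage R)).IsExpansionOn M] {γ : Type*}
    (t : (L.sum (relLanguage R)).Term γ) : ∃ t' : L.Term γ, ∀ a : γ → M,
      t.realize a = t'.realize a := by
  induction t with
  | var i => exact ⟨Term.var i, fun a => rfl⟩
  | func f ts ih =>
    choose ts' h using ih
    rcases f with f | f
    · refine ⟨Term.func f ts', fun a => ?_⟩
      simp only [Term.realize, h]
      exact LHom.map_onFunction (LHom.sumInl : L →ᴸ L.sum (relLanguage R)) f _
    · exact nomatch f

/-- In an expansion by predicates on leading terms, every definable predicate is a projection of the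
conjunction of an `L`-definable relation with a predicate on leading terms. -/
theorem rvDef_of_boundedFormula (hmin : IsOneHMinimal.{u, v, max u v x} ι T)
    (N : VModel.{u, v, max u v x} ι T) [(L.sum (relLanguage R)).Structure N]
    [(LHom.sumInl : L →ᴸ L.sum (relLanguage R)).IsExpansionOn N]
    (hrel : ∀ (k : ℕ) (s : R k), ∃ n : ℕ+, ∀ b b' : Fin k → N, RVEq N.O n b b' →
      Structure.RelMap (L := L.sum (relLanguage R)) (Sum.inr s) b →
      Structure.RelMap (L := L.sum (relLanguage R)) (Sum.inr s) b')
    {α : Type} [Finite α] {n : ℕ} (φ : (L.sum (relLanguage R)).BoundedFormula α n) :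
    RVDef N fun w : α ⊕ Fin n → N =>
      φ.Realize (fun i => w (Sum.inl i)) (fun i => w (Sum.inr i)) := by
  have hw : ∀ {n : ℕ} (w : α ⊕ Fin n → N),
      Sum.elim (fun i => w (Sum.inl i)) (fun i => w (Sum.inr i)) = w := by
    intro n w
    funext i
    rcases i with i | i <;> rfl
  induction φ with
  | falsum => exact RVDef.of_uDef (UDef.const False) N
  | equal t₁ t₂ =>
    obtain ⟨t₁', h₁⟩ := exists_term_of_sum (M := N) t₁
    obtain ⟨t₂', h₂⟩ := exists_term_of_sum (M := N) t₂
    refine (RVDef.of_uDef ((UFun.of_term t₁').eq (UFun.of_term t₂')) N).congr fun w => ?_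
    simp only [BoundedFormula.Realize, hw, h₁, h₂]
  | @rel n k s ts =>
    choose ts' h using fun i => exists_term_of_sum (M := N) (ts i)
    rcases s with s | s
    · refine (RVDef.of_uDef (UDef.of_formula (Relations.formula s ts')) N).congr fun w => ?_
      simp only [BoundedFormula.Realize, hw, h, Formula.realize_rel]
      exact (iff_of_eq (LHom.map_onRelation (LHom.sumInl : L →ᴸ L.sum (relLanguage R)) s _)).symm
    · obtain ⟨m, hm⟩ := hrel k s
      refine (RVDef.of_rv (fun i => UFun.of_term (ts' i)) m hm).congr fun w => ?_
      simp only [BoundedFormula.Realize, hw, h]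
  | imp φ ψ ih₁ ih₂ =>
    refine (RVDef.not hmin (ih₁.and (RVDef.not hmin ih₂))).congr fun w => ?_
    simp only [BoundedFormula.Realize]
    tauto
  | @all n φ ih =>
    refine (RVDef.not hmin (RVDef.ex (RVDef.not hmin (ih.reindex
      (Sum.elim (fun i => some (Sum.inl i)) (Fin.snoc (α := fun _ => Option (α ⊕ Fin n))
        (fun i => some (Sum.inr i)) none)))))).congr fun w => ?_
    simp only [BoundedFormula.Realize]
    push Not
    refine forall_congr' fun y => iff_of_eq (congrArg (φ.Realize _) (funext fun i => ?_))
    refine Fin.lastCases ?_ (fun i => ?_) i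
    · simp
    · simp

end Expansion

/-! ### Unions of families of partial functions -/

section Family

variable {L : FirstOrder.Language.{u, v}} {ι : langVal →ᴸ L} {T : L.Theory} {α β : Type} [Finite β]

/-- The graph of the function that the relation `R` defines over `a` and `e`, extended by zero to
the arguments for which `R` does not define a unique value. -/
def UniqueGraph {K : Type*} [Zero K] (R : (α → K) → (β → K) → K → K → Prop)
    (a : α → K) (e : β → K) (y z : K) : Prop :=
  (R a e y z ∧ ∀ z', R a e y z' → z' = z) ∨ ((¬ ∃ z₀, R a e y z₀ ∧ ∀ z', R a e y z' → z' = z₀) ∧ z = 0)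

variable {R : ∀ N : VModel.{u, v, x} ι T, (α → N) → (β → N) → N → N → Prop}

omit [Finite β] in
theorem UDef.uniqueGraph (hR : UDef fun N (w : Option (Option (α ⊕ β)) → N) =>
    R N (fun i => w (some (some (Sum.inl i)))) (fun i => w (some (some (Sum.inr i))))
      (w (some none)) (w none)) :
    UDef fun N (w : Option (Option (α ⊕ β)) → N) =>
      UniqueGraph (R N) (fun i => w (some (some (Sum.inl i)))) (fun i => w (some (some (Sum.inr i))))
      (w (some none)) (w none) := by
  have h1 : UDef fun N (w : Option (Option (α ⊕ β)) → N) =>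
      R N (fun i => w (some (some (Sum.inl i)))) (fun i => w (some (some (Sum.inr i))))
        (w (some none)) (w none) ∧ ∀ z',
      R N (fun i => w (some (some (Sum.inl i)))) (fun i => w (some (some (Sum.inr i))))
        (w (some none)) z' → z' = w none := by
    refine hR.and (UDef.all (P := fun N (w : Option (Option (α ⊕ β)) → N) z' =>
      R N (fun i => w (some (some (Sum.inl i)))) (fun i => w (some (some (Sum.inr i))))
        (w (some none)) z' → z' = w none) ?_)
    exact (hR.reindex fun o => o.elim none fun o => some (some o)).imp
      ((UFun.var _).eq (UFun.var _))
  refine h1.or (UDef.and (UDef.not ?_) ((UFun.var _).eq UFun.zero))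
  exact (UDef.ex (P := fun N (w : Option (α ⊕ β) → N) z₀ =>
    R N (fun i => w (some (Sum.inl i))) (fun i => w (some (Sum.inr i))) (w none) z₀ ∧
    ∀ z', R N (fun i => w (some (Sum.inl i))) (fun i => w (some (Sum.inr i))) (w none) z' →
      z' = z₀) h1).reindex some

omit [Finite β] in
theorem UniqueGraph.exists_function {K : Type*} [Zero K]
    (R : (α → K) → (β → K) → K → K → Prop) (a : α → K) (e : β → K) :
    ∃ g : K → K, ∀ y z, UniqueGraph R a e y z ↔ z = g y := by
  classical
  refine ⟨fun y => if h : ∃ z₀, R a e y z₀ ∧ ∀ z', R a e y z' → z' = z₀ then h.choose else 0,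
    fun y z => ?_⟩
  dsimp only
  by_cases h : ∃ z₀, R a e y z₀ ∧ ∀ z', R a e y z' → z' = z₀
  · rw [dif_pos h]
    constructor
    · rintro (h' | h')
      · exact h.choose_spec.2 z h'.1
      · exact absurd h h'.1
    · rintro rfl
      exact Or.inl h.choose_spec
  · rw [dif_neg h]
    constructor
    · rintro (h' | h')
      · exact absurd ⟨z, h'⟩ h
      · exact h'.2
    · exact fun hz => Or.inr ⟨h, hz⟩

omit [Finite β] in
theorem UniqueGraph.goodFibre {N : VModel.{u, v, x} ι T} {n : ℕ+}
    {R : (α → N) → (β → N) → N → N → Prop} {a : α → N}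
    (hinv : ∀ e e', RVEq N.O n e e' → ∀ y z, R a e y z → R a e' y z) (e : β → N) :
    GoodFibre n (UniqueGraph R) a e := by
  obtain ⟨g, hg⟩ := UniqueGraph.exists_function R a e
  refine ⟨fun y => ⟨g y, (hg _ _).2 rfl⟩, fun y z z' h h' => ?_, fun e' he y z => ?_⟩
  · rw [(hg _ _).1 h, (hg _ _).1 h']
  · have : ∀ y z, R a e y z ↔ R a e' y z := fun y z => ⟨hinv _ _ he y z, hinv _ _ he.symm y z⟩
    simp only [UniqueGraph, this]

end Family

section Functions

variable {L : FirstOrder.Language.{u, v}} {ι : langVal →ᴸ L} {T : L.Theory} {α β : Type} [Finite β]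
  {N : VModel.{u, v, max u v x} ι T}
  {R : ∀ N : VModel.{u, v, max u v x} ι T, (α → N) → (β → N) → N → N → Prop}
  (hR : UDef fun N (w : Option (Option (α ⊕ β)) → N) =>
    R N (fun i => w (some (some (Sum.inl i)))) (fun i => w (some (some (Sum.inr i))))
      (w (some none)) (w none))
  {n : ℕ+} (hinv : ∀ a e e', RVEq N.O n e e' → ∀ y z, R N a e y z → R N a e' y z)

include hR hinv in
/-- Property (T1) for a function `f` that is the union of some members of a definable family of
partial functions, parametrized by a power of `RV_{|n|}`: on each ball that is next to a suitable
finite set, `f` agrees with one member of the family. -/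
theorem t1_of_family (hmin : IsOneHMinimal.{u, v, max u v x} ι T) :
    ∃ (Ψ : ∀ N : VModel.{u, v, max u v x} ι T, (α → N) → N → Prop) (m : ℕ+),
      (UDef fun N (w : Option α → N) => Ψ N (fun i => w (some i)) (w none)) ∧
      ∀ a : α → N, {y | Ψ N a y}.Finite ∧ {y | Ψ N a y}.Nonempty ∧
        ∀ (f : N → N) (Z : (β → N) → Prop), (∀ y z, z = f y ↔ ∃ e, Z e ∧ R N a e y z) →
          T1At N.O {y | Ψ N a y} m f := by
  obtain ⟨Ψ₁, m₁, hΨ₁, h₁⟩ := uniform_t1 hR.uniqueGraph hmin n N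
    fun a e => UniqueGraph.goodFibre (hinv a) e
  obtain ⟨Ψ₂, m₂, hΨ₂, h₂⟩ := uniform_preparation hmin n
    (R := fun N a e y => ∃ z, R N a e y z)
    (UDef.ex (P := fun N (w : Option (α ⊕ β) → N) z => R N (fun i => w (some (Sum.inl i)))
      (fun i => w (some (Sum.inr i))) (w none) z) hR) N
    fun a e e' he y ⟨z, hz⟩ => ⟨z, hinv _ _ _ he _ _ hz⟩
  refine ⟨fun N a y => (Ψ₁ N a y ∨ Ψ₂ N a y) ∨ y = 0, m₁ * m₂,
    (hΨ₁.or hΨ₂).or ((UFun.var _).eq UFun.zero), fun a => ⟨?_, ⟨0, Or.inr rfl⟩, ?_⟩⟩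
  · exact (((h₁ a).1.union (h₂ a).1).union (Set.finite_singleton 0)).subset fun y hy => hy
  intro f Z hf
  set C := {y | (Ψ₁ N a y ∨ Ψ₂ N a y) ∨ y = 0} with hC
  rw [t1At_iff]
  intro y₀ hy₀
  obtain ⟨e, he, hey⟩ := (hf y₀ _).1 rfl
  obtain ⟨g, hg⟩ := UniqueGraph.exists_function (R N) a e
  have hfg : ∀ y, SameBall N.O (m₁ * m₂) C y₀ y → f y = g y := by
    intro y hy
    obtain ⟨z, hz⟩ := ((h₂ a).2 e y₀ y (fun h => hy₀ (Or.inl (Or.inr h)))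
      (hy.mono (fun c hc => Or.inl (Or.inr hc)) (Dvd.intro_left _ rfl))).2 ⟨_, hey⟩
    have key : ∀ z', R N a e y z' → z' = f y := fun z' hz' => (hf y z').2 ⟨e, he, hz'⟩
    rw [← hg, ← key z hz]
    exact Or.inl ⟨hz, fun z' hz' => (key z' hz').trans (key z hz).symm⟩
  have hT : T1At N.O C (m₁ * m₂) g := ((h₁ a).2 e g hg).mono
    (fun c hc => Or.inl (Or.inl hc)) (Dvd.intro _ rfl)
  obtain ⟨z, hz⟩ := t1At_iff.1 hT y₀ hy₀
  refine ⟨z, fun y y' hy hy' => ?_⟩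
  rw [hfg y hy, hfg y' hy']
  exact hz y y' hy hy'

include hR hinv in
/-- Property (T2) for a function `f` that is the union of some members of a definable family of
partial functions, parametrized by a power of `RV_{|n|}`: apart from the finitely many values with
an infinite fibre for some member of the family, the fibres of `f` are contained in unions of
families of finite sets that are parametrized by a power of `RV_{|n|}`. -/
theorem t2_of_family (hmin : IsOneHMinimal.{u, v, max u v x} ι T) (a : α → N) (f : N → N)
    (Z : (β → N) → Prop) (hf : ∀ y z, z = f y ↔ ∃ e, Z e ∧ R N a e y z) : PropertyT2 f := by
  have hG := hR.uniqueGraph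
  have hGinv : ∀ e e', RVEq N.O n e e' → ∀ y z, UniqueGraph (R N) a e y z →
      UniqueGraph (R N) a e' y z := fun e e' he y z =>
    ((UniqueGraph.goodFibre (hinv a) e).2.2 e' he y z).1
  have hY : {z | ∃ e, HasBall N.O {y | UniqueGraph (R N) a e y z}}.Finite := by
    refine finite_iUnion_rv_of_finite hmin β
      (P := fun N a e z => HasBall N.O {y | UniqueGraph (R N) a e y z}) ?_ N a n ?_ ?_
    · exact UDef.hasBall (P := fun N (w : Option (α ⊕ β) → N) y => UniqueGraph (R N)
        (fun i => w (some (Sum.inl i))) (fun i => w (some (Sum.inr i))) y (w none))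
        (hG.reindex fun o => o.elim (some none) fun o => o.elim none fun i => some (some i))
    · exact fun e e' he z h => h.mono fun y hy => hGinv e e' he y z hy
    · intro e
      obtain ⟨g, hg⟩ := UniqueGraph.exists_function (R N) a e
      have hT2 : PropertyT2 g := (t1_t2_of_uDef hmin (α := α ⊕ β)
        (G := fun N w y z => UniqueGraph (R N) (fun i => w (Sum.inl i)) (fun i => w (Sum.inr i)) y z)
        hG N (Sum.elim a e) g hg).2
      refine hT2.subset fun z hz => ?_
      refine (HasBall.infinite N.valued.nontrivial hz).mono fun y hy => ?_
      exact ((hg y z).1 hy).symm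
  refine hY.subset fun z hz => ?_
  by_contra hno
  refine hz ((finite_iUnion_rv_of_finite hmin β (α := Option α)
    (P := fun N a e y => UniqueGraph (R N) (fun i => a (some i)) e y (a none)) ?_ N
    (fun o => o.elim z a) n ?_ ?_).subset ?_)
  · exact hG.reindex fun o => o.elim (some (Sum.inl none)) fun o => o.elim none
      (Sum.elim (fun i => some (Sum.inl (some i))) fun i => some (Sum.inr i))
  · exact fun e e' he y => hGinv e e' he y z
  · intro e
    by_contra hinf
    refine hno ⟨e, ?_⟩
    exact hasBall_of_infinite hmin (α := Option (α ⊕ β))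
      (P := fun N w y => UniqueGraph (R N) (fun i => w (some (Sum.inl i)))
        (fun i => w (some (Sum.inr i))) y (w none))
      (hG.reindex fun o => o.elim (some none) fun o => o.elim none fun i => some (some i)) N
      (fun o => o.elim z (Sum.elim a e)) hinf
  · intro y hy
    have hy' : z = f y := hy.symm
    obtain ⟨e, he, hey⟩ := (hf y z).1 hy'
    exact ⟨e, Or.inl ⟨hey, fun z' hz' => ((hf y z').2 ⟨e, he, hz'⟩).trans hy'.symm⟩⟩

end Functions

/-! ### 1-h-minimality of the expansion -/

theorem exists_formula_of_definable {L : FirstOrder.Language.{u, v}} {M : Type w} [L.Structure M]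
    {A : Set M} {α : Type} {S : Set (α → M)} (h : A.Definable L S) :
    ∃ (p : ℕ) (a : Fin p → M) (φ : L.Formula (Fin p ⊕ α)), (∀ i, a i ∈ A) ∧
      S = {y | φ.Realize (Sum.elim a y)} := by
  obtain ⟨A₀, hA₀, h⟩ := Set.definable_iff_finitely_definable.1 h
  obtain ⟨φ, rfl⟩ := Set.definable_iff_exists_formula_sum.1 h
  let e := A₀.equivFin
  refine ⟨A₀.card, fun i => e.symm i, φ.relabel (Sum.map (fun c => e c) id),
    fun i => hA₀ (e.symm i).2, ?_⟩
  ext y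
  change Formula.Realize _ _ ↔ Formula.Realize _ _
  rw [Formula.realize_relabel]
  refine iff_of_eq (congrArg _ (funext fun o => ?_))
  rcases o with c | i
  · simp
  · rfl

section Invariance

variable {L : FirstOrder.Language.{u, v}} (ι : langVal →ᴸ L)

/-- The sentence stating that the relation `s` is invariant under equality of leading terms. -/
noncomputable def invSentence (n : ℕ+) {k : ℕ} (s : L.Relations k) : L.Sentence :=
  Formula.iAlls (Fin k ⊕ Fin k) (α := Empty)
    ((Formula.iInf fun i => (rvFormula ι n).relabel ![Sum.inr (Sum.inl i), Sum.inr (Sum.inr i)]) ⟹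
      ((Relations.formula s fun i => Term.var (Sum.inr (Sum.inl i))) ⟹
        (Relations.formula s fun i => Term.var (Sum.inr (Sum.inr i)))))

theorem realize_invSentence {ι} {M : Type*} [Field M] [CharZero M] [L.Structure M]
    {O : ValuationSubring M} (hO : IsValuedFieldStructure ι M O) (n : ℕ+) {k : ℕ}
    (s : L.Relations k) : M ⊨ invSentence ι n s ↔
      ∀ b b' : Fin k → M, RVEq O n b b' → Structure.RelMap s b → Structure.RelMap s b' := by
  rw [Sentence.Realize, invSentence, Formula.realize_iAlls]
  have key : ∀ q : Fin k ⊕ Fin k → M, Formula.Realize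
      ((Formula.iInf fun i => (rvFormula ι n).relabel
        (![Sum.inr (Sum.inl i), Sum.inr (Sum.inr i)] : Fin 2 → Empty ⊕ (Fin k ⊕ Fin k))) ⟹
      ((Relations.formula s fun i => Term.var (Sum.inr (Sum.inl i))) ⟹
        (Relations.formula s fun i => Term.var (Sum.inr (Sum.inr i))))) (Sum.elim default q) ↔
      (RVEq O n (fun i => q (Sum.inl i)) (fun i => q (Sum.inr i)) →
        Structure.RelMap s (fun i => q (Sum.inl i)) →
        Structure.RelMap s (fun i => q (Sum.inr i))) := by
    intro q
    rw [Formula.realize_imp, Formula.realize_imp, Formula.realize_iInf, Formula.realize_rel,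
      Formula.realize_rel]
    simp only [Formula.realize_relabel, realize_rvFormula hO]
    exact Iff.rfl
  constructor
  · intro h b b'
    exact (key (Sum.elim b b')).1 (h (Sum.elim b b'))
  · intro h q
    exact (key q).2 (h _ _)

end Invariance

section Expansion

variable {L : FirstOrder.Language.{u, v}} {ι : langVal →ᴸ L} {R : ℕ → Type r}

theorem IsValuedFieldStructure.of_expansion {M : Type*} [Field M] [L.Structure M]
    [(L.sum (relLanguage R)).Structure M]
    [(LHom.sumInl : L →ᴸ L.sum (relLanguage R)).IsExpansionOn M] {O : ValuationSubring M}
    (h : IsValuedFieldStructure ((LHom.sumInl : L →ᴸ L.sum (relLanguage R)).comp ι) M O) :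
    IsValuedFieldStructure ι M O where
  nontrivial := h.nontrivial
  map_add x y := by
    rw [← h.map_add]
    exact (LHom.map_onFunction (LHom.sumInl : L →ᴸ L.sum (relLanguage R)) _ _).symm
  map_mul x y := by
    rw [← h.map_mul]
    exact (LHom.map_onFunction (LHom.sumInl : L →ᴸ L.sum (relLanguage R)) _ _).symm
  map_ring x := by
    rw [← h.map_ring]
    exact iff_of_eq
      (LHom.map_onRelation (LHom.sumInl : L →ᴸ L.sum (relLanguage R)) _ _).symm

theorem IsValuedFieldStructure.expansion {M : Type*} [Field M] [L.Structure M]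
    [(L.sum (relLanguage R)).Structure M]
    [(LHom.sumInl : L →ᴸ L.sum (relLanguage R)).IsExpansionOn M] {O : ValuationSubring M}
    (h : IsValuedFieldStructure ι M O) :
    IsValuedFieldStructure ((LHom.sumInl : L →ᴸ L.sum (relLanguage R)).comp ι) M O where
  nontrivial := h.nontrivial
  map_add x y := by
    rw [← h.map_add]
    exact LHom.map_onFunction (LHom.sumInl : L →ᴸ L.sum (relLanguage R)) _ _
  map_mul x y := by
    rw [← h.map_mul]
    exact LHom.map_onFunction (LHom.sumInl : L →ᴸ L.sum (relLanguage R)) _ _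
  map_ring x := by
    rw [← h.map_ring]
    exact iff_of_eq
      (LHom.map_onRelation (LHom.sumInl : L →ᴸ L.sum (relLanguage R)) _ _)

variable {K : Type w} [Field K] [CharZero K] [L.Structure K] {O : ValuationSubring K}
  (P : ∀ k, R k → RVPredicate O k)

theorem models_rvExpansionTheory_iff {M : Type*} [(L.sum (relLanguage R)).Structure M] :
    letI := rvStructure P
    M ⊨ rvExpansionTheory L P ↔ ∀ φ : (L.sum (relLanguage R)).Sentence, K ⊨ φ → M ⊨ φ := by
  rw [Theory.model_iff]
  exact Iff.rfl

theorem models_completeTheory_of_rvExpansion {M : Type*} [L.Structure M]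
    [(L.sum (relLanguage R)).Structure M]
    [(LHom.sumInl : L →ᴸ L.sum (relLanguage R)).IsExpansionOn M]
    (hM : M ⊨ rvExpansionTheory L P) : M ⊨ L.completeTheory K := by
  let _ := rvStructure P
  rw [models_rvExpansionTheory_iff] at hM
  rw [Theory.model_iff]
  intro φ hφ
  rw [← LHom.realize_onSentence M (LHom.sumInl : L →ᴸ L.sum (relLanguage R))]
  refine hM _ ?_
  rw [LHom.realize_onSentence K (LHom.sumInl : L →ᴸ L.sum (relLanguage R))]
  exact hφ

/-- In all models of the theory of the expansion, the additional predicates are invariant under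
equality of leading terms. -/
theorem relMap_of_rvEq (hK : IsValuedFieldStructure ι K O) {M : Type*} [Field M] [CharZero M]
    [(L.sum (relLanguage R)).Structure M] {O' : ValuationSubring M}
    (hO' : IsValuedFieldStructure ((LHom.sumInl : L →ᴸ L.sum (relLanguage R)).comp ι) M O')
    (hM : M ⊨ rvExpansionTheory L P) (k : ℕ) (s : R k) :
    ∃ n : ℕ+, ∀ b b' : Fin k → M, RVEq O' n b b' →
      Structure.RelMap (L := L.sum (relLanguage R)) (Sum.inr s) b →
      Structure.RelMap (L := L.sum (relLanguage R)) (Sum.inr s) b' := by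
  let _ := rvStructure P
  rw [models_rvExpansionTheory_iff] at hM
  have hK' := hK.expansion (R := R)
  set n : ℕ+ := ∏ i, (P k s).level i
  let rel : (L.sum (relLanguage R)).Relations k := Sum.inr s
  refine ⟨n, (realize_invSentence hO' n rel).1 (hM _ ((realize_invSentence hK' n rel).2 ?_))⟩
  intro b b' hb h
  have e : (fun i => rv O ((P k s).level i) (b i)) = fun i => rv O ((P k s).level i) (b' i) :=
    funext fun i => rv_eq_of_dvd O (Finset.dvd_prod_of_mem _ (Finset.mem_univ i)) (hb i)
  change (fun i => rv O ((P k s).level i) (b' i)) ∈ (P k s).carrier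
  rw [← e]
  exact h

/-- Expansions by predicates on leading terms preserve 1-h-minimality. -/
theorem isOneHMinimal_rvExpansion (hK : IsValuedFieldStructure ι K O)
    (hmin : IsOneHMinimal.{u, v, max u v x} ι (L.completeTheory K)) :
    IsOneHMinimal.{u, max v r, max u v x} ((LHom.sumInl : L →ᴸ L.sum (relLanguage R)).comp ι)
      (rvExpansionTheory L P) := by
  intro M _ _ _ O' hO' hM n₀ A B f hf
  let : L.Structure M := (LHom.sumInl : L →ᴸ L.sum (relLanguage R)).reduct M
  have : (LHom.sumInl : L →ᴸ L.sum (relLanguage R)).IsExpansionOn M :=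
    LHom.isExpansionOn_reduct _ _
  let N : VModel.{u, v, max u v x} ι (L.completeTheory K) :=
    { carrier := M, O := O', valued := hO'.of_expansion,
      models := models_completeTheory_of_rvExpansion P hM }
  let : (L.sum (relLanguage R)).Structure N := inferInstanceAs ((L.sum (relLanguage R)).Structure M)
  have : (LHom.sumInl : L →ᴸ L.sum (relLanguage R)).IsExpansionOn N :=
    LHom.isExpansionOn_reduct _ _
  obtain ⟨k, ξ, S, hξ, hS, hfS⟩ := hf
  obtain ⟨p, a, φ, ha, rfl⟩ := exists_formula_of_definable hS
  obtain ⟨β, hβ, n₁, R₀, Z, hR₀, hZ, hX⟩ :=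
    (rvDef_of_boundedFormula hmin N (relMap_of_rvEq P hK hO' hM) φ).reindex
      (Sum.elim id Fin.elim0)
  let R₂ : ∀ N : VModel.{u, v, max u v x} ι (L.completeTheory K), (Fin p → N) → (Fin k ⊕ β → N) →
      N → N → Prop := fun N a e y z =>
    R₀ N (Sum.elim a (Sum.elim (fun i => e (Sum.inl i)) ![y, z])) fun i => e (Sum.inr i)
  -- The relation is made invariant under equality of leading terms of its parameters.
  let R₁ : ∀ N : VModel.{u, v, max u v x} ι (L.completeTheory K), (Fin p → N) → (Fin k ⊕ β → N) →
      N → N → Prop := fun N a e y z => ∃ e', RVEq N.O (n₀ * n₁) e e' ∧ R₂ N a e' y z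
  have hR₁ : UDef fun N (w : Option (Option (Fin p ⊕ (Fin k ⊕ β))) → N) =>
      R₁ N (fun i => w (some (some (Sum.inl i)))) (fun i => w (some (some (Sum.inr i))))
        (w (some none)) (w none) := by
    refine UDef.exs (P := fun N (w : Option (Option (Fin p ⊕ (Fin k ⊕ β))) → N) e' =>
      RVEq N.O (n₀ * n₁) (fun i => w (some (some (Sum.inr i)))) e' ∧
        R₂ N (fun i => w (some (some (Sum.inl i)))) e' (w (some none)) (w none))
      ((UDef.rvEq _ _ _).and ?_)
    refine (hR₀.reindex (Sum.elim (Sum.elim (fun i => Sum.inl (some (some (Sum.inl i))))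
      (Sum.elim (fun i => Sum.inr (Sum.inl i)) ![Sum.inl (some none), Sum.inl none]))
      fun i => Sum.inr (Sum.inr i))).congr fun N w => ?_
    refine iff_of_eq (congrArg (fun f => R₀ N f _) (funext fun o => ?_))
    rcases o with i | i | i
    · rfl
    · rfl
    · fin_cases i <;> rfl
  have hinv : ∀ a e e', RVEq N.O (n₀ * n₁) e e' → ∀ y z, R₁ N a e y z → R₁ N a e' y z :=
    fun a e e' he y z ⟨e₁, h1, h2⟩ => ⟨e₁, he.symm.trans h1, h2⟩
  let Z₁ : (Fin k ⊕ β → N) → Prop := fun e =>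
    (∀ i, rv O' n₀ (e (Sum.inl i)) = ξ i) ∧ Z fun i => e (Sum.inr i)
  have hφ : ∀ (b : Fin k → M) (y z : M), (∀ i, rv O' n₀ (b i) = ξ i) →
      (z = f y ↔ ∃ e, R₀ N (Sum.elim a (Sum.elim b ![y, z])) e ∧ Z e) := by
    intro b y z hb
    refine Iff.trans ?_ (hX _)
    have h1 : (![y, z] : Fin 2 → M) ∈ {x : Fin 2 → M | x 1 = f (x 0)} ↔ z = f y := Iff.rfl
    rw [← h1, hfS b hb]
    refine iff_of_eq ?_
    change BoundedFormula.Realize φ _ _ = BoundedFormula.Realize φ _ _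
    congr 1
    exact Subsingleton.elim _ _
  have hfR : ∀ y z, z = f y ↔ ∃ e, Z₁ e ∧ R₁ N a e y z := by
    intro y z
    constructor
    · intro h
      choose b hb using fun i => rv_surjective O' n₀ (ξ i)
      obtain ⟨e, h1, h2⟩ := (hφ b y z hb).1 h
      exact ⟨Sum.elim b e, ⟨hb, h2⟩, _, RVEq.refl _, h1⟩
    · rintro ⟨e, ⟨h1, h2⟩, e', h3, h4⟩
      refine (hφ (fun i => e' (Sum.inl i)) y z fun i => ?_).2 ⟨_, h4, hZ _ _ (fun i => ?_) h2⟩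
      · exact (((h3.of_dvd (Dvd.intro _ rfl)) _).symm).trans (h1 i)
      · exact (h3.of_dvd (Dvd.intro_left _ rfl)) _
  refine ⟨?_, t2_of_family hR₁ hinv hmin a f Z₁ hfR⟩
  obtain ⟨Ψ, m, hΨ, h⟩ := t1_of_family hR₁ hinv hmin
  refine ⟨{y | Ψ N a y}, m, (h a).1, (h a).2.1, ?_, (h a).2.2 f Z₁ hfR⟩
  refine ⟨0, Fin.elim0, {w | Ψ N a (w (Sum.inr 0))}, fun i => i.elim0, ?_, fun b _ => rfl⟩
  have hd := definable_of_uDef (P := fun N (w : Fin p ⊕ (Fin 0 ⊕ Fin 1) → N) =>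
    Ψ N (fun i => w (Sum.inl i)) (w (Sum.inr (Sum.inr 0))))
    (hΨ.reindex fun o => o.elim (Sum.inr (Sum.inr 0)) Sum.inl) N a
  have hd' := hd.map_expansion (LHom.sumInl : L →ᴸ L.sum (relLanguage R))
  exact hd'.mono (by rintro _ ⟨i, rfl⟩; exact ha i)

end Expansion

/-! ### Splitting finite sets by orders on the leading terms -/

section Splitting

variable {L : FirstOrder.Language.{u, v}} {p s : ℕ}

/-- For a parameter `d` and a tuple `q`: if `q` enumerates without repetition the set that `φ`
defines over `d`, then `θ` splits this set properly. -/
noncomputable def splitFormula (s : ℕ) (φ θ : L.Formula (Option (Fin p))) :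
    L.Formula (Empty ⊕ (Fin p ⊕ Fin s)) :=
  let f : Option (Fin p) → (Empty ⊕ (Fin p ⊕ Fin s)) ⊕ Unit :=
    fun o => o.elim (Sum.inr ()) fun i => Sum.inl (Sum.inr (Sum.inl i))
  (Formula.iInf fun ij : {ij : Fin s × Fin s // ij.1 ≠ ij.2} =>
    ((Term.var (Sum.inr (Sum.inr ij.1.1))).equal (Term.var (Sum.inr (Sum.inr ij.1.2)))).not) ⟹
  (Formula.iAlls Unit ((φ.relabel f).iff (Formula.iSup fun i : Fin s =>
      (Term.var (Sum.inr ())).equal (Term.var (Sum.inl (Sum.inr (Sum.inr i))))))) ⟹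
  (Formula.iExs Unit ((φ ⊓ θ).relabel f) ⊓ Formula.iExs Unit ((φ ⊓ θ.not).relabel f))

/-- The sentence stating that each member of the family of sets defined by `φ` that has `s`
elements is properly split by the corresponding member of the family defined by `θ`. -/
noncomputable def splitSentence (s : ℕ) (φ θ : L.Formula (Option (Fin p))) : L.Sentence :=
  Formula.iAlls (Fin p ⊕ Fin s) (α := Empty) (splitFormula s φ θ)

theorem realize_splitFormula {M : Type*} [L.Structure M] (φ θ : L.Formula (Option (Fin p)))
    (d : Fin p → M) (q : Fin s → M) :
    (splitFormula s φ θ).Realize (Sum.elim default (Sum.elim d q)) ↔ (Function.Injective q →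
      (∀ y, φ.Realize (fun o => o.elim y d) ↔ ∃ i, y = q i) →
      (∃ y, φ.Realize (fun o => o.elim y d) ∧ θ.Realize (fun o => o.elim y d)) ∧
      ∃ y, φ.Realize (fun o => o.elim y d) ∧ ¬ θ.Realize (fun o => o.elim y d)) := by
  have e : ∀ y : Unit → M,
      (Sum.elim (Sum.elim (default : Empty → M) (Sum.elim d q)) y ∘
        fun o : Option (Fin p) => (o.elim (Sum.inr ()) fun i => Sum.inl (Sum.inr (Sum.inl i)) :
          (Empty ⊕ (Fin p ⊕ Fin s)) ⊕ Unit)) = fun o => o.elim (y ()) d := by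
    intro y
    funext o
    rcases o with _ | i <;> rfl
  have hu : ∀ X : M → Prop, (∃ y : Unit → M, X (y ())) ↔ ∃ y, X y := fun X =>
    ⟨fun ⟨y, h⟩ => ⟨_, h⟩, fun ⟨y, h⟩ => ⟨fun _ => y, h⟩⟩
  have hu' : ∀ X : M → Prop, (∀ y : Unit → M, X (y ())) ↔ ∀ y, X y := fun X =>
    ⟨fun h y => h fun _ => y, fun h y => h _⟩
  have hq : Function.Injective q ↔
      ∀ ij : {ij : Fin s × Fin s // ij.1 ≠ ij.2}, ¬ q ij.1.1 = q ij.1.2 :=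
    ⟨fun h ij hij => ij.2 (h hij), fun h i j hij => by
      by_contra hne
      exact h ⟨(i, j), hne⟩ hij⟩
  simp only [splitFormula]
  rw [Formula.realize_imp, Formula.realize_imp, Formula.realize_iInf, Formula.realize_iAlls,
    Formula.realize_inf, Formula.realize_iExs, Formula.realize_iExs]
  simp only [Formula.realize_relabel, Formula.realize_iff, Formula.realize_inf,
    Formula.realize_not, Formula.realize_iSup, Formula.realize_equal, Term.realize_var,
    Sum.elim_inl, Sum.elim_inr, e, hq]
  rw [hu fun y => φ.Realize (fun o => o.elim y d) ∧ θ.Realize (fun o => o.elim y d),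
    hu fun y => φ.Realize (fun o => o.elim y d) ∧ ¬ θ.Realize (fun o => o.elim y d),
    hu' fun y => φ.Realize (fun o => o.elim y d) ↔ ∃ i, y = q i]

theorem realize_splitSentence {M : Type*} [L.Structure M] (φ θ : L.Formula (Option (Fin p))) :
    M ⊨ splitSentence s φ θ ↔ ∀ (d : Fin p → M) (q : Fin s → M), Function.Injective q →
      (∀ y, φ.Realize (fun o => o.elim y d) ↔ ∃ i, y = q i) →
      (∃ y, φ.Realize (fun o => o.elim y d) ∧ θ.Realize (fun o => o.elim y d)) ∧
      ∃ y, φ.Realize (fun o => o.elim y d) ∧ ¬ θ.Realize (fun o => o.elim y d) := by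
  rw [Sentence.Realize, splitSentence, Formula.realize_iAlls]
  constructor
  · intro h d q
    exact (realize_splitFormula φ θ d q).1 (h _)
  · intro h dq
    have : dq = Sum.elim (fun i => dq (Sum.inl i)) fun i => dq (Sum.inr i) := by
      funext i; rcases i with i | i <;> rfl
    rw [this]
    exact (realize_splitFormula φ θ _ _).2 (h _ _)

/-- If the finite definable sets with at least two elements can be properly split by definable sets,
then the algebraic closure is equal to the definable closure. -/
theorem acl_eq_dcl_of_split {M : Type*} [L.Structure M]
    (h : ∀ (p s : ℕ) (φ : L.Formula (Option (Fin p))), s ≠ 0 →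
      ∃ θ : L.Formula (Option (Fin p)), M ⊨ splitSentence (s + 1) φ θ) (A : Set M) :
    acl L A = dcl L A := by
  refine Set.Subset.antisymm ?_ fun a ha => ⟨{a}, Set.finite_singleton a, ha, rfl⟩
  rintro a ⟨C, hC, hd, ha⟩
  induction hn : C.ncard using Nat.strong_induction_on generalizing C with
  | _ n ih =>
  subst hn
  by_cases hC1 : C = {a}
  · change A.Definable₁ L {a}
    rw [← hC1]
    exact hd
  obtain ⟨p, c, φ, hc, hφ⟩ := exists_formula_of_definable hd
  have hφC : ∀ y, (φ.relabel (Sum.elim some fun _ => none)).Realize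
      (fun o : Option (Fin p) => o.elim y c) ↔ y ∈ C := by
    intro y
    have h1 : (fun _ : Fin 1 => y) ∈ {x : Fin 1 → M | x 0 ∈ C} ↔ y ∈ C := Iff.rfl
    rw [← h1, hφ, Formula.realize_relabel]
    refine iff_of_eq (congrArg _ (funext fun o => ?_))
    rcases o with i | i <;> rfl
  have hpos : C.ncard ≠ 0 := fun h0 => by
    rw [Set.ncard_eq_zero hC] at h0
    rw [h0] at ha
    exact ha
  obtain ⟨s, hs⟩ := Nat.exists_eq_succ_of_ne_zero hpos
  have hs0 : s ≠ 0 := by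
    rintro rfl
    obtain ⟨b, hb⟩ := Set.ncard_eq_one.1 hs
    rw [hb] at ha hC1
    exact hC1 (by rw [Set.mem_singleton_iff.1 ha])
  obtain ⟨θ, hθ⟩ := h p s (φ.relabel (Sum.elim some fun _ => none)) hs0
  obtain ⟨q, hq, hqC⟩ := (ncard_eq_iff_exists_enum hC).1 hs
  obtain ⟨⟨y₁, h1, h2⟩, y₂, h3, h4⟩ := (realize_splitSentence _ _).1 hθ c q hq
    fun y => (hφC y).trans (hqC y)
  rw [hφC] at h1 h3
  have hD : A.Definable L {x : Fin 1 → M | θ.Realize fun o => o.elim (x 0) c} := by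
    refine Set.Definable.mono (A := Set.range c) ?_ (by rintro _ ⟨i, rfl⟩; exact hc i)
    rw [Set.definable_iff_exists_formula_sum]
    refine ⟨θ.relabel fun o => o.elim (Sum.inr 0) fun i => Sum.inl ⟨c i, i, rfl⟩, ?_⟩
    ext x
    change Formula.Realize _ _ ↔ Formula.Realize _ _
    rw [Formula.realize_relabel]
    refine iff_of_eq (congrArg _ (funext fun o => ?_))
    rcases o with _ | i <;> rfl
  by_cases hay : θ.Realize fun o => o.elim a c
  · refine ih _ ?_ (C ∩ {y | θ.Realize fun o => o.elim y c}) (hC.subset Set.inter_subset_left)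
      (hd.inter hD) ⟨ha, hay⟩ rfl
    refine Set.ncard_lt_ncard ⟨Set.inter_subset_left, fun h => h4 (h h3).2⟩ hC
  · refine ih _ ?_ (C \ {y | θ.Realize fun o => o.elim y c}) (hC.subset Set.sdiff_subset)
      (hd.sdiff hD) ⟨ha, hay⟩ rfl
    refine Set.ncard_lt_ncard ⟨Set.sdiff_subset, fun h => (h h1).2 h2⟩ hC

end Splitting

section Orders

/-- Binary relation symbols, one for each integer `n ≥ 1`. -/
inductive OrderSymbol : ℕ → Type r
  | le (n : ℕ+) : OrderSymbol 2

variable {L : FirstOrder.Language.{u, v}} {ι : langVal →ᴸ L}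
  {K : Type w} [Field K] [CharZero K] [L.Structure K]

/-- The predicates given by a linear order, in fact a well-order, on each `RV_{|n|}`. -/
def orderPredicate (O : ValuationSubring K) : ∀ k, OrderSymbol.{r} k → RVPredicate O k
  | _, OrderSymbol.le n => ⟨fun _ => n, {ξ | ¬ WellOrderingRel (ξ 1) (ξ 0)}⟩

theorem UDef.rel {T : L.Theory} {α : Type} {t s : ∀ N : VModel.{u, v, x} ι T, (α → N) → N}
    (S : L.Relations 2) (ht : UFun t) (hs : UFun s) :
    UDef fun N v => Structure.RelMap S ![t N v, s N v] := by
  refine ht.subst (P := fun N v y => Structure.RelMap S ![y, s N v]) ?_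
  refine (hs.reindex some).subst (P := fun N v y => Structure.RelMap S ![v none, y]) ?_
  refine (UDef.of_formula (Relations.formula S ![Term.var (some none), Term.var none])).congr
    fun N v => ?_
  rw [Formula.realize_rel]
  refine iff_of_eq (congrArg _ (funext fun i => ?_))
  fin_cases i <;> rfl

/-- In the expansion by orders, finite sets are split by those of their elements whose leading
term, relative to the average, is minimal. -/
theorem exists_splitSentence {O : ValuationSubring K} (hK : IsValuedFieldStructure ι K O)
    {p s : ℕ} (hs : s ≠ 0)
    (φ : (L.sum (relLanguage OrderSymbol.{r})).Formula (Option (Fin p))) :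
    let _ := rvStructure (orderPredicate.{w, r} O)
    ∃ θ : (L.sum (relLanguage OrderSymbol.{r})).Formula (Option (Fin p)),
      K ⊨ splitSentence (s + 1) φ θ := by
  intro _
  let L' := L.sum (relLanguage OrderSymbol.{r})
  let ι' : langVal →ᴸ L' := (LHom.sumInl : L →ᴸ L').comp ι
  let S : L'.Relations 2 := Sum.inr (OrderSymbol.le s.succPNat)
  have hS : ∀ y z : K, Structure.RelMap S ![y, z] ↔
      ¬ WellOrderingRel (rv O s.succPNat z) (rv O s.succPNat y) := fun y z => Iff.rfl
  let N : VModel.{u, max v r, w} ι' ∅ :=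
    { carrier := K, O := O, valued := hK.expansion, models := inferInstance }
  have hφ : UDef fun (N : VModel.{u, max v r, w} ι' ∅) (w : Option (Fin p) → N) => φ.Realize w :=
    UDef.of_formula φ
  obtain ⟨θ, hθ⟩ : UDef fun (N : VModel.{u, max v r, w} ι' ∅) (w : Option (Fin p) → N) =>
      ∀ q : Fin (s + 1) → N, ((∀ i j, q i = q j → i = j) ∧
        ∀ y, φ.Realize (fun o => o.elim y fun i => w (some i)) ↔ ∃ i, y = q i) →
      ∀ i, Structure.RelMap S ![((s + 1 : ℕ) : N) * w none - ∑ j, q j,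
        ((s + 1 : ℕ) : N) * q i - ∑ j, q j] := by
    refine UDef.alls (P := fun (N : VModel.{u, max v r, w} ι' ∅) (w : Option (Fin p) → N)
      (q : Fin (s + 1) → N) => ((∀ i j, q i = q j → i = j) ∧
        ∀ y, φ.Realize (fun o => o.elim y fun i => w (some i)) ↔ ∃ i, y = q i) →
      ∀ i, Structure.RelMap S ![((s + 1 : ℕ) : N) * w none - ∑ j, q j,
        ((s + 1 : ℕ) : N) * q i - ∑ j, q j]) ?_
    refine UDef.imp (UDef.and ?_ ?_) ?_
    · exact UDef.forall_finite fun i => UDef.forall_finite fun j =>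
        ((UFun.var _).eq (UFun.var _)).imp (UDef.const _)
    · refine UDef.all (P := fun (N : VModel.{u, max v r, w} ι' ∅)
        (w : Option (Fin p) ⊕ Fin (s + 1) → N) y =>
        φ.Realize (fun o => o.elim y fun i => w (Sum.inl (some i))) ↔ ∃ i, y = w (Sum.inr i)) ?_
      refine UDef.iff ?_ (UDef.exists_finite fun i => (UFun.var _).eq (UFun.var _))
      refine (hφ.reindex fun o => o.elim none fun i => some (Sum.inl (some i))).congr
        fun N w => iff_of_eq (congrArg _ (funext fun o => ?_))
      rcases o with _ | i <;> rfl
    · have hsum : UFun fun (N : VModel.{u, max v r, w} ι' ∅)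
          (w : Option (Fin p) ⊕ Fin (s + 1) → N) => ∑ j, w (Sum.inr j) :=
        UFun.sum fun i => UFun.var _
      exact UDef.forall_finite fun i => UDef.rel S (((UFun.natCast _).mul (UFun.var _)).sub hsum)
        (((UFun.natCast _).mul (UFun.var _)).sub hsum)
  refine ⟨θ, (realize_splitSentence φ θ).2 fun d q hq hqφ => ?_⟩
  -- The enumeration `q` is only determined up to order, but its sum is determined.
  have hθ' : ∀ y : K, θ.Realize (fun o => o.elim y d) ↔
      ∀ i, Structure.RelMap S ![((s + 1 : ℕ) : K) * y - ∑ j, q j,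
        ((s + 1 : ℕ) : K) * q i - ∑ j, q j] := by
    intro y
    refine (hθ N _).trans ⟨fun h => h q ⟨fun i j hij => hq hij, hqφ⟩, fun h q' hq' i => ?_⟩
    have hsum : ∑ j, q' j = ∑ j, q j := by
      rw [← finsum_mem_eq_of_enum (S := {y | φ.Realize fun o => o.elim y d}) hq hqφ]
      exact (finsum_mem_eq_of_enum (S := {y | φ.Realize fun o => o.elim y d})
        (fun i j hij => hq'.1 i j hij) hq'.2).symm
    obtain ⟨j, hj⟩ := (hqφ (q' i)).1 ((hq'.2 (q' i)).2 ⟨i, rfl⟩)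
    have := h j
    rw [← hj, ← hsum] at this
    exact this
  simp only [hθ', hS]
  let key : Fin (s + 1) → RV O s.succPNat := fun i =>
    rv O s.succPNat (((s + 1 : ℕ) : K) * q i - ∑ j, q j)
  obtain ⟨_, ⟨i₀, rfl⟩, hmin⟩ := (IsWellFounded.wf (r := (WellOrderingRel :
    RV O s.succPNat → RV O s.succPNat → Prop))).has_min (Set.range key) ⟨_, 0, rfl⟩
  obtain ⟨i₁, hi₁⟩ := exists_rv_average_ne (O := O) hs hq
    (((s + 1 : ℕ) : K) * q i₀ - ∑ j, q j)
  refine ⟨⟨q i₀, (hqφ _).2 ⟨i₀, rfl⟩, fun i => hmin _ ⟨i, rfl⟩⟩,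
    ⟨q i₁, (hqφ _).2 ⟨i₁, rfl⟩, fun h => hi₁ ?_⟩⟩
  rcases trichotomous_of WellOrderingRel (key i₀) (key i₁) with h' | h' | h'
  · exact (h i₀ h').elim
  · exact h'.symm
  · exact (hmin _ ⟨i₁, rfl⟩ h').elim

end Orders

end HMin


theorem mainTheorem10 {L : FirstOrder.Language.{u, v}} (ι : HMin.langVal →ᴸ L)
    (K : Type w) [Field K] [CharZero K] [L.Structure K] (O : ValuationSubring K)
    (hK : HMin.IsValuedFieldStructure ι K O)
    (hmin : HMin.IsOneHMinimal.{u, v, max u v w} ι (L.completeTheory K)) :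
    ∃ (R : ℕ → Type (max u v)) (P : ∀ k, R k → HMin.RVPredicate O k),
      HMin.IsOneHMinimal.{u, max u v, max u v w}
          ((FirstOrder.Language.LHom.sumInl : L →ᴸ L.sum (HMin.relLanguage R)).comp ι)
          (HMin.rvExpansionTheory L P) ∧
        ∀ (M : Type (max u v w)) [(L.sum (HMin.relLanguage R)).Structure M],
          M ⊨ HMin.rvExpansionTheory L P →
            ∀ A : Set M,
              HMin.acl (L.sum (HMin.relLanguage R)) A = HMin.dcl (L.sum (HMin.relLanguage R)) A := by
  refine ⟨HMin.OrderSymbol, HMin.orderPredicate O,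
    HMin.isOneHMinimal_rvExpansion _ hK hmin, fun M _ hM A => ?_⟩
  refine HMin.acl_eq_dcl_of_split (fun p s φ hs => ?_) A
  obtain ⟨θ, hθ⟩ := HMin.exists_splitSentence hK hs φ
  exact ⟨θ, (HMin.models_rvExpansionTheory_iff _).1 hM _ hθ⟩
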